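/- Let $d\in\mathbb N$, let $F:\mathbb R^d\to\mathbb R$ be differentiable, and let $f:\mathbb R^d\to\mathbb R$ be a random function such that $\mathbb E[\nabla f(x)]=\nabla F(x)$ for all $x\in\mathbb R^d$. Let $(f_n)_{n\ge1}$ be i.i.d. samples of $f$. Let $\epsilon>0$, $F_*\in\mathbb R$, $R\ge\sqrt\epsilon$ and $L$ be such that for all $x,y\in\mathbb R^d$: $$F(x)\ge F_*,\qquad \|\nabla f(x)\|_\infty\le R-\sqrt\epsilon\ \text{ almost surely},\qquad \|\nabla F(x)-\nabla F(y)\|_2\le L\|x-y\|_2 .$$ Let $0\le\beta_1<\beta_2<1$, $\alpha>0$, and $\alpha_n=\alpha(1-\beta_1)\sqrt{\frac{1-\beta_2^n}{1-\beta_2}}$ for $n\ge1$. Given $x_0\in\mathbb R^d$, $m_0=0$ and $v_0=0$, define for $n\ge1$ and each coordinate $i\in\{1,\dots,d\}$ (Adam with momentum) $$m_{n,i}=\beta_1m_{n-1,i}+\nabla_if_n(x_{n-1}),\qquad v_{n,i}=\beta_2v_{n-1,i}+\bigl(\nabla_if_n(x_{n-1})\bigr)^2,\qquad x_{n,i}=x_{n-1,i}-\alpha_n\frac{m_{n,i}}{\sqrt{\epsilon+v_{n,i}}}.$$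 Let $N$ be a positive integer with $N>\frac{\beta_1}{1-\beta_1}$, put $\tilde N=N-\frac{\beta_1}{1-\beta_1}$, and let $\tau$ be a random index in $\{0,\dots,N-1\}$, independent of $(f_n)_{n\ge1}$, with $\mathbb P(\tau=j)\propto1-\beta_1^{N-j}$ for $0\le j<N$. Then $\|\nabla F(x_\tau)\|_2^2$ is integrable and $$\mathbb E\bigl[\|\nabla F(x_\tau)\|_2^2\bigr]\le 2R\,\frac{F(x_0)-F_*}{\alpha\tilde N}+C\left(\frac1{\tilde N}\ln\Bigl(1+\frac{R^2}{(1-\beta_2)\epsilon}\Bigr)-\frac N{\tilde N}\ln\beta_2\right),$$ where $$C=\frac{\alpha dRL(1-\beta_1)}{(1-\beta_1/\beta_2)(1-\beta_2)}+\frac{12dR^2\sqrt{1-\beta_1}}{(1-\beta_1/\beta_2)^{3/2}\sqrt{1-\beta_2}}+\frac{2\alpha^2dL^2\beta_1}{(1-\beta_1/\beta_2)(1-\beta_2)^{3/2}} .$$ Moreover $C$ is of order $O((1-\beta_1)^{-1})$ as long as the ratio $\frac{1-\beta_1}{1-\beta_1/\beta_2}$ stays bounded (it is close to $1$ when $\beta_1/\beta_2\approx\beta_1$),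 in the sense that $$C\le\Bigl(\frac{1-\beta_1}{1-\beta_1/\beta_2}\Bigr)^{3/2}\left(\frac{\alpha dRL}{1-\beta_2}+\frac{12dR^2}{\sqrt{1-\beta_2}}+\frac{2\alpha^2dL^2}{(1-\beta_2)^{3/2}}\right)\frac1{1-\beta_1}.$$ -/

import Mathlib

open MeasureTheory ProbabilityTheory

/-- The state `(m, v, x)` of the algorithm: momentum, decayed sum of squared gradients, iterate. -/
structure AdamState (d : ℕ) where
  m : EuclideanSpace ℝ (Fin d)
  v : EuclideanSpace ℝ (Fin d)
  x : EuclideanSpace ℝ (Fin d)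

/-- The step size at iteration `n ≥ 1`: `α (1 - β₁) √((1 - β₂ ^ n) / (1 - β₂))`. -/
noncomputable def adamStepSize (α β₁ β₂ : ℝ) (n : ℕ) : ℝ :=
  α * (1 - β₁) * Real.sqrt ((1 - β₂ ^ n) / (1 - β₂))

/-- The `m`-update: `mₙ = β₁ mₙ₋₁ + g`. -/
noncomputable def adamNextM {d : ℕ} (β₁ : ℝ) (m g : EuclideanSpace ℝ (Fin d)) :
    EuclideanSpace ℝ (Fin d) :=
  WithLp.toLp 2 fun i => β₁ * m i + g i

/-- The `v`-update: `vₙ = β₂ vₙ₋₁ + g ^ 2`, coordinate by coordinate. -/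
noncomputable def adamNextV {d : ℕ} (β₂ : ℝ) (v g : EuclideanSpace ℝ (Fin d)) :
    EuclideanSpace ℝ (Fin d) :=
  WithLp.toLp 2 fun i => β₂ * v i + g i ^ 2

/-- The `x`-update: `xₙ = xₙ₋₁ - a mₙ / √(ε + vₙ)`, coordinate by coordinate, step size `a`. -/
noncomputable def adamNextX {d : ℕ} (ε a : ℝ) (x m v : EuclideanSpace ℝ (Fin d)) :
    EuclideanSpace ℝ (Fin d) :=
  WithLp.toLp 2 fun i => x i - a * (m i / Real.sqrt (ε + v i))

/-- Adam with heavy-ball momentum, started at `m₀ = 0`, `v₀ = 0`, `x₀`, and run on the sequence of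
functions `h`. Iteration `n + 1` uses the gradient of `h n` at the current iterate `xₙ`, so that
`h 0, h 1, h 2, …` are the successive functions returned by the oracle. -/
noncomputable def adamState {d : ℕ} (α β₁ β₂ ε : ℝ) (h : ℕ → EuclideanSpace ℝ (Fin d) → ℝ)
    (x₀ : EuclideanSpace ℝ (Fin d)) : ℕ → AdamState d
  | 0 => ⟨0, 0, x₀⟩
  | n + 1 =>
    let s := adamState α β₁ β₂ ε h x₀ n
    let g := gradient (h n) s.x
    let m := adamNextM β₁ s.m g
    let v := adamNextV β₂ s.v g
    ⟨m, v, adamNextX ε (adamStepSize α β₁ β₂ (n + 1)) s.x m v⟩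

/-- The constant `C` of the bound. -/
noncomputable def adamConst (d : ℕ) (α β₁ β₂ R L : ℝ) : ℝ :=
  α * d * R * L * (1 - β₁) / ((1 - β₁ / β₂) * (1 - β₂))
    + 12 * d * R ^ 2 * Real.sqrt (1 - β₁)
        / ((1 - β₁ / β₂) ^ (3 / 2 : ℝ) * Real.sqrt (1 - β₂))
    + 2 * α ^ 2 * d * L ^ 2 * β₁ / ((1 - β₁ / β₂) * (1 - β₂) ^ (3 / 2 : ℝ))

/-!
The proof is an energy argument for `F`, run in expectation. Write `g n` for the stochastic gradient
at the `n`-th iterate, `G n` for the true one, `U j = g j / √(ε + v (j + 1))` and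
`u n = m (n + 1) / √(ε + v (n + 1))`, coordinate by coordinate, and `q = β₁ / β₂`.

Along each trajectory the descent lemma bounds the sum of `αₙ₊₁ ⟨G n, u n⟩` by `F x₀ - Fstar` plus a
multiple of the sum of `‖u n‖ ^ 2`. The momentum is a geometric average of past gradients `g j`, and
replacing `G n` by `G j` in front of `g j` costs, by Young's inequality and smoothness, only
multiples of `‖u l‖ ^ 2` and `U j ^ 2` (`le_sum_mul_momentum_div`, `sum_mul_div_sqrt_le`). All these
errors are logarithmic: the sum of `U j ^ 2` telescopes in `log (ε + v)`
(`sum_sq_div_add_decayed_sq_le`), and it controls the sum of `u n ^ 2` because an older denominator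
differs from a newer one by a factor at most `β₂⁻¹` per step, which turns the weights `β₁ ^ k` into
`q ^ k` (`sum_sq_momentum_div_le`). The powers of `1 - β₁` and `1 - q` in the constant come from
sums such as `∑ q ^ k √(k + 1)`, bounded by Cauchy-Schwarz.

What remains is the expectation of `G j * g j / √(ε + v (n + 1))`. Given the past before sample `j`,
`g j` has mean `G j`, but the denominator depends on `g j` and on later samples. Replacing the
contribution of the samples `j, …, n` to `v (n + 1)` by its conditional mean makes the denominator
known given the past, and a second use of Young's inequality shows that this costs half of the
main term and another multiple of `U j ^ 2` (`le_integral_mul_div_sqrt`). The step size is chosen to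
cancel the growth of the denominator, so the main term is a multiple of `𝔼 ‖G j‖ ^ 2`, and summing
the weights `β₁ ^ (n - j)` over `n` gives `1 - β₁ ^ (N - j)`: the law of `τ`
(`sum_weighted_integral_norm_sq_gradient_le`). That `g j` has conditional mean `G j` is Fubini's
theorem for the independent pair formed by the past and the sample `j` (`condExp_of_indep`).
-/

/-! ### Convolution sums and geometric series -/

open Finset in
theorem sum_range_convolution_le {c b : ℕ → ℝ} (hc : ∀ k, 0 ≤ c k) (hb : ∀ k, 0 ≤ b k) (N : ℕ) :
    ∑ n ∈ range N, ∑ j ∈ range (n + 1), c (n - j) * b j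
      ≤ (∑ k ∈ range N, c k) * ∑ j ∈ range N, b j := by
  rw [sum_range_diag_flip N fun j k => c k * b j, mul_sum]
  refine sum_le_sum fun j _ => ?_
  rw [← sum_mul]
  refine mul_le_mul_of_nonneg_right ?_ (hb j)
  exact sum_le_sum_of_subset_of_nonneg (range_mono (Nat.sub_le _ _)) fun k _ _ => hc k

open Finset in
/-- Each `b l` lies in exactly `k` of the windows `[j, j + k)` of length `k`. -/
theorem sum_range_window_le {c b : ℕ → ℝ} (hc : ∀ k, 0 ≤ c k) (hb : ∀ k, 0 ≤ b k) (N : ℕ) :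
    ∑ n ∈ range N, ∑ j ∈ range (n + 1), c (n - j) * ∑ l ∈ Ico j n, b l
      ≤ (∑ k ∈ range N, c k * k) * ∑ j ∈ range N, b j := by
  have h1 : ∑ n ∈ range N, ∑ j ∈ range (n + 1), c (n - j) * ∑ l ∈ Ico j n, b l
      = ∑ n ∈ range N, ∑ j ∈ range (n + 1),
        (fun j k => c k * ∑ p ∈ range k, b (j + p)) j (n - j) := by
    refine sum_congr rfl fun n _ => sum_congr rfl fun j _ => ?_
    simp only [sum_Ico_eq_sum_range]
  have h2 : ∑ j ∈ range N, ∑ k ∈ range (N - j), c k * ∑ p ∈ range k, b (j + p)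
      = ∑ k ∈ range N, ∑ j ∈ range (N - k), c k * ∑ p ∈ range k, b (j + p) := by
    refine sum_comm' fun x y => ?_
    simp only [mem_range]
    omega
  rw [h1, sum_range_diag_flip N fun j k => c k * ∑ p ∈ range k, b (j + p), h2, sum_mul]
  refine sum_le_sum fun k hk => ?_
  rw [← mul_sum, mul_assoc]
  refine mul_le_mul_of_nonneg_left ?_ (hc k)
  rw [sum_comm]
  calc ∑ p ∈ range k, ∑ j ∈ range (N - k), b (j + p)
      ≤ ∑ p ∈ range k, ∑ l ∈ range N, b l := by
        refine sum_le_sum fun p hp => ?_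
        have := sum_Ico_eq_sum_range b p (N - k + p)
        rw [Nat.add_sub_cancel] at this
        simp only [add_comm _ p] at this ⊢
        rw [← this]
        refine sum_le_sum_of_subset_of_nonneg (fun l hl => ?_) fun l _ _ => hb l
        simp only [mem_Ico, mem_range] at *
        omega
    _ = k * ∑ l ∈ range N, b l := by simp

theorem sum_range_choose_mul_pow_le {q : ℝ} (h0 : 0 ≤ q) (h1 : q < 1) (p N : ℕ) :
    ∑ k ∈ Finset.range N, ((k + p).choose p : ℝ) * q ^ k ≤ 1 / (1 - q) ^ (p + 1) :=
  sum_le_hasSum _ (fun k _ => by positivity)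
    (hasSum_choose_mul_geometric_of_norm_lt_one p
      (by rwa [Real.norm_eq_abs, abs_of_nonneg h0]))

theorem sum_range_pow_le {q : ℝ} (h0 : 0 ≤ q) (h1 : q < 1) (N : ℕ) :
    ∑ k ∈ Finset.range N, q ^ k ≤ 1 / (1 - q) := by
  simpa using sum_range_choose_mul_pow_le h0 h1 0 N

theorem sum_range_succ_mul_pow_le {q : ℝ} (h0 : 0 ≤ q) (h1 : q < 1) (N : ℕ) :
    ∑ k ∈ Finset.range N, ((k : ℝ) + 1) * q ^ k ≤ 1 / (1 - q) ^ 2 := by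
  simpa using sum_range_choose_mul_pow_le h0 h1 1 N

theorem sum_range_succ_sq_mul_pow_le {q : ℝ} (h0 : 0 ≤ q) (h1 : q < 1) (N : ℕ) :
    ∑ k ∈ Finset.range N, ((k : ℝ) + 1) ^ 2 * q ^ k ≤ 2 / (1 - q) ^ 3 := by
  have h := mul_le_mul_of_nonneg_left (sum_range_choose_mul_pow_le h0 h1 2 N) (zero_le_two (α := ℝ))
  rw [Finset.mul_sum, mul_one_div] at h
  refine le_trans (Finset.sum_le_sum fun k _ => ?_) h
  rw [← mul_assoc]
  refine mul_le_mul_of_nonneg_right ?_ (by positivity)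
  rw [Nat.cast_choose_two]
  push_cast
  nlinarith [(Nat.cast_nonneg k : (0 : ℝ) ≤ k)]

theorem sum_range_pow_mul_sqrt_succ_le {q : ℝ} (h0 : 0 ≤ q) (h1 : q < 1) (N : ℕ) :
    ∑ k ∈ Finset.range N, q ^ k * √(k + 1) ≤ 1 / ((1 - q) * √(1 - q)) := by
  have hq : 0 < 1 - q := sub_pos.2 h1
  calc ∑ k ∈ Finset.range N, q ^ k * √(k + 1)
      = ∑ k ∈ Finset.range N, √(q ^ k) * √((k + 1) * q ^ k) := by
        refine Finset.sum_congr rfl fun k _ => ?_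
        rw [Real.sqrt_mul (by positivity), mul_left_comm, Real.mul_self_sqrt (by positivity),
          mul_comm]
    _ ≤ √(∑ k ∈ Finset.range N, q ^ k) * √(∑ k ∈ Finset.range N, ((k : ℝ) + 1) * q ^ k) :=
        Real.sum_sqrt_mul_sqrt_le _ (fun k => by positivity) (fun k => by positivity)
    _ ≤ √(1 / (1 - q)) * √(1 / (1 - q) ^ 2) := by
        gcongr
        · exact sum_range_pow_le h0 h1 N
        · exact sum_range_succ_mul_pow_le h0 h1 N
    _ = 1 / ((1 - q) * √(1 - q)) := by
        rw [Real.sqrt_div zero_le_one, Real.sqrt_div zero_le_one, Real.sqrt_sq hq.le, Real.sqrt_one]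
        field_simp

theorem sum_range_succ_mul_sqrt_succ_mul_pow_le {q : ℝ} (h0 : 0 ≤ q) (h1 : q < 1) (N : ℕ) :
    ∑ k ∈ Finset.range N, ((k : ℝ) + 1) * √(k + 1) * q ^ k ≤ 4 / ((1 - q) ^ 2 * √(1 - q)) := by
  have hq : 0 < 1 - q := sub_pos.2 h1
  calc ∑ k ∈ Finset.range N, ((k : ℝ) + 1) * √(k + 1) * q ^ k
      = ∑ k ∈ Finset.range N, √((k + 1) * q ^ k) * √((k + 1) ^ 2 * q ^ k) := by
        refine Finset.sum_congr rfl fun k _ => ?_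
        rw [Real.sqrt_mul (by positivity), Real.sqrt_mul (by positivity),
          Real.sqrt_sq (by positivity)]
        have := Real.mul_self_sqrt (show 0 ≤ q ^ k by positivity)
        linear_combination (-((k : ℝ) + 1) * √(k + 1)) * this
    _ ≤ √(∑ k ∈ Finset.range N, ((k : ℝ) + 1) * q ^ k)
        * √(∑ k ∈ Finset.range N, ((k : ℝ) + 1) ^ 2 * q ^ k) :=
        Real.sum_sqrt_mul_sqrt_le _ (fun k => by positivity) (fun k => by positivity)
    _ ≤ √(1 / (1 - q) ^ 2) * √((4 / (1 - q)) ^ 2 / (1 - q)) := by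
        gcongr
        · exact sum_range_succ_mul_pow_le h0 h1 N
        · refine (sum_range_succ_sq_mul_pow_le h0 h1 N).trans ?_
          rw [div_pow, div_div, ← pow_succ]
          gcongr
          norm_num
    _ = 4 / ((1 - q) ^ 2 * √(1 - q)) := by
        rw [Real.sqrt_div zero_le_one, Real.sqrt_div (by positivity), Real.sqrt_sq hq.le,
          Real.sqrt_one, Real.sqrt_sq (by positivity)]
        field_simp

theorem sum_range_pow_mul_sq_div_sqrt_le {q : ℝ} (h0 : 0 ≤ q) (h1 : q < 1) (N : ℕ) :
    ∑ k ∈ Finset.range N, q ^ k * (k / √(k + 1)) * k ≤ 4 * q / ((1 - q) ^ 2 * √(1 - q)) := by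
  have hq : 0 < 1 - q := sub_pos.2 h1
  rcases N with _ | N
  · simp only [Finset.range_zero, Finset.sum_empty]
    positivity
  rw [Finset.sum_range_succ']
  simp only [Nat.cast_zero, mul_zero, add_zero, Nat.cast_add, Nat.cast_one]
  calc ∑ k ∈ Finset.range N, q ^ (k + 1) * (((k : ℝ) + 1) / √(k + 1 + 1)) * (k + 1)
      ≤ ∑ k ∈ Finset.range N, q * (((k : ℝ) + 1) * √(k + 1) * q ^ k) := by
        refine Finset.sum_le_sum fun k _ => ?_
        have h : ((k : ℝ) + 1) / √(k + 1 + 1) ≤ √(k + 1) := by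
          rw [div_le_iff₀ (by positivity)]
          calc (k : ℝ) + 1 = √(k + 1) * √(k + 1) := (Real.mul_self_sqrt (by positivity)).symm
            _ ≤ √(k + 1) * √(k + 1 + 1) := by gcongr; linarith
        calc q ^ (k + 1) * (((k : ℝ) + 1) / √(k + 1 + 1)) * (k + 1)
            ≤ q ^ (k + 1) * √(k + 1) * (k + 1) := by gcongr
          _ = _ := by ring
    _ = q * ∑ k ∈ Finset.range N, (((k : ℝ) + 1) * √(k + 1) * q ^ k) := by rw [Finset.mul_sum]
    _ ≤ q * (4 / ((1 - q) ^ 2 * √(1 - q))) := by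
        gcongr
        exact sum_range_succ_mul_sqrt_succ_mul_pow_le h0 h1 N
    _ = _ := by ring

/-! ### Scalar recursions for momentum and squared gradients -/

theorem decayed_sum_eq {β : ℝ} {g m : ℕ → ℝ} (hm0 : m 0 = 0)
    (hm : ∀ n, m (n + 1) = β * m n + g n) (n : ℕ) :
    m n = ∑ j ∈ Finset.range n, β ^ (n - 1 - j) * g j := by
  induction n with
  | zero => simpa using hm0
  | succ n ih =>
    rw [hm, Finset.sum_range_succ, ih, Finset.mul_sum]
    congr 1
    · refine Finset.sum_congr rfl fun j hj => ?_
      have : n + 1 - 1 - j = (n - 1 - j) + 1 := by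
        have := Finset.mem_range.1 hj
        omega
      rw [this]
      ring
    · simp

theorem pow_mul_decayed_sq_le {β : ℝ} {g v : ℕ → ℝ} (hβ : 0 ≤ β)
    (hv : ∀ n, v (n + 1) = β * v n + g n ^ 2) {j n : ℕ} (hjn : j ≤ n) :
    β ^ (n - j) * v j ≤ v n := by
  induction n, hjn using Nat.le_induction with
  | base => simp
  | succ n hjn ih =>
    rw [Nat.succ_sub hjn, hv n, Nat.succ_eq_add_one, pow_succ', mul_assoc]
    have := mul_le_mul_of_nonneg_left ih hβ
    nlinarith [sq_nonneg (g n)]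

/-- The `n - j` most recent squared gradients contribute at most `(n - j) * R ^ 2`. -/
theorem decayed_sq_sub_le {β R : ℝ} {g v : ℕ → ℝ} (hβ : 0 ≤ β) (hβ1 : β < 1)
    (hv : ∀ n, v (n + 1) = β * v n + g n ^ 2) (hg : ∀ n, |g n| ≤ R) {j n : ℕ} (hjn : j ≤ n) :
    v n - β ^ (n - j) * v j ≤ ((n - j : ℕ) : ℝ) * R ^ 2 := by
  induction n, hjn using Nat.le_induction with
  | base => simp
  | succ n hjn ih =>
    have h2 : g n ^ 2 ≤ R ^ 2 := sq_le_sq' (abs_le.1 (hg n)).1 (abs_le.1 (hg n)).2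
    have h1 := pow_mul_decayed_sq_le hβ hv hjn
    rw [Nat.succ_sub hjn, hv, Nat.succ_eq_add_one, pow_succ' β]
    push_cast
    nlinarith [mul_le_mul_of_nonneg_right hβ1.le (sub_nonneg.2 h1)]

section Scalar

variable {β₁ β₂ ε R : ℝ} {g m v : ℕ → ℝ}

theorem decayed_sq_nonneg (hβ₂ : 0 ≤ β₂) (hv0 : v 0 = 0)
    (hv : ∀ n, v (n + 1) = β₂ * v n + g n ^ 2) (n : ℕ) : 0 ≤ v n := by
  induction n with
  | zero => exact hv0.ge
  | succ n ih => rw [hv]; positivity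

theorem decayed_sq_le (hβ₂ : 0 ≤ β₂) (hβ₂1 : β₂ < 1) (hv0 : v 0 = 0)
    (hv : ∀ n, v (n + 1) = β₂ * v n + g n ^ 2) (hg : ∀ n, |g n| ≤ R) (n : ℕ) :
    v n ≤ R ^ 2 * ((1 - β₂ ^ n) / (1 - β₂)) := by
  have h1 : 0 < 1 - β₂ := sub_pos.2 hβ₂1
  induction n with
  | zero => simp [hv0]
  | succ n ih =>
    have h2 : g n ^ 2 ≤ R ^ 2 := sq_le_sq' (abs_le.1 (hg n)).1 (abs_le.1 (hg n)).2
    have h3 := mul_le_mul_of_nonneg_left ih hβ₂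
    rw [hv]
    have h4 : R ^ 2 * ((1 - β₂ ^ (n + 1)) / (1 - β₂))
        = β₂ * (R ^ 2 * ((1 - β₂ ^ n) / (1 - β₂))) + R ^ 2 := by
      field_simp
      ring
    linarith

theorem decayed_sq_le_div (hβ₂ : 0 ≤ β₂) (hβ₂1 : β₂ < 1) (hv0 : v 0 = 0)
    (hv : ∀ n, v (n + 1) = β₂ * v n + g n ^ 2) (hg : ∀ n, |g n| ≤ R) (n : ℕ) :
    v n ≤ R ^ 2 / (1 - β₂) := by
  have h1 : 0 < 1 - β₂ := sub_pos.2 hβ₂1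
  refine (decayed_sq_le hβ₂ hβ₂1 hv0 hv hg n).trans ?_
  rw [← mul_div_assoc]
  gcongr
  have := pow_nonneg hβ₂ n
  nlinarith [sq_nonneg R]

/-- The room `√ε` left in the bound on the gradients absorbs the regularization `ε`, because the
weights `1 + β₂ + ⋯ + β₂ ^ n` sum to at least `1`. -/
theorem add_decayed_sq_le (hβ₂ : 0 ≤ β₂) (hβ₂1 : β₂ < 1) (hε : 0 ≤ ε) (hv0 : v 0 = 0)
    (hv : ∀ n, v (n + 1) = β₂ * v n + g n ^ 2) (hg : ∀ n, |g n| ≤ R - √ε) (n : ℕ) :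
    ε + v (n + 1) ≤ R ^ 2 * ((1 - β₂ ^ (n + 1)) / (1 - β₂)) := by
  have h1 : 0 < 1 - β₂ := sub_pos.2 hβ₂1
  have hB : 0 ≤ R - √ε := (abs_nonneg _).trans (hg 0)
  have hS : 1 ≤ (1 - β₂ ^ (n + 1)) / (1 - β₂) := by
    rw [one_le_div h1]
    have := pow_le_of_le_one hβ₂ hβ₂1.le n.succ_ne_zero
    rw [Nat.succ_eq_add_one] at this
    linarith
  have h2 := decayed_sq_le hβ₂ hβ₂1 hv0 hv hg (n + 1)
  have h3 := Real.sq_sqrt hε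
  set S := (1 - β₂ ^ (n + 1)) / (1 - β₂)
  have h4 : ε + (R - √ε) ^ 2 ≤ R ^ 2 := by nlinarith [Real.sqrt_nonneg ε]
  nlinarith

/-- Replacing the denominator of a later iteration by the current one costs a factor `β₂⁻¹` per
iteration. -/
theorem sq_div_add_decayed_sq_le (hβ₂ : 0 < β₂) (hβ₂1 : β₂ < 1) (hε : 0 < ε) (hv0 : v 0 = 0)
    (hv : ∀ n, v (n + 1) = β₂ * v n + g n ^ 2) {j n : ℕ} (hjn : j ≤ n) :
    g j ^ 2 / (ε + v (n + 1)) ≤ (β₂ ^ (n - j))⁻¹ * (g j ^ 2 / (ε + v (j + 1))) := by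
  have hvn := decayed_sq_nonneg hβ₂.le hv0 hv
  have h1 : β₂ ^ (n - j) * v (j + 1) ≤ v (n + 1) := by
    have := pow_mul_decayed_sq_le hβ₂.le hv (Nat.succ_le_succ hjn)
    rwa [Nat.succ_eq_add_one, Nat.succ_eq_add_one, Nat.add_sub_add_right] at this
  have h2 : β₂ ^ (n - j) * ε ≤ ε := mul_le_of_le_one_left hε.le (pow_le_one₀ hβ₂.le hβ₂1.le)
  have h3 := hvn (j + 1)
  have h4 := hvn (n + 1)
  rw [← div_eq_inv_mul, div_div]
  refine div_le_div_of_nonneg_left (sq_nonneg _) (by positivity) ?_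
  nlinarith

/-- The normalized squared gradients sum up logarithmically:
`g² / (ε + v) ≤ log (ε + v) - log (ε + v - g²)` telescopes up to `-log β₂` per term. -/
theorem sum_sq_div_add_decayed_sq_le (hβ₂ : 0 < β₂) (hβ₂1 : β₂ < 1) (hε : 0 < ε) (hv0 : v 0 = 0)
    (hv : ∀ n, v (n + 1) = β₂ * v n + g n ^ 2) (hg : ∀ n, |g n| ≤ R) (N : ℕ) :
    ∑ n ∈ Finset.range N, g n ^ 2 / (ε + v (n + 1))
      ≤ Real.log (1 + R ^ 2 / ((1 - β₂) * ε)) - N * Real.log β₂ := by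
  have hvn := decayed_sq_nonneg hβ₂.le hv0 hv
  have key : ∑ n ∈ Finset.range N, g n ^ 2 / (ε + v (n + 1))
      ≤ Real.log ((ε + v N) / ε) - N * Real.log β₂ := by
    induction N with
    | zero => simp [hv0, hε.ne']
    | succ N ih =>
      have h0 := hvn N
      have h1 := hvn (N + 1)
      have hstep : g N ^ 2 / (ε + v (N + 1))
          ≤ Real.log (ε + v (N + 1)) - Real.log (ε + v N) - Real.log β₂ := by
        have h2 : 0 < β₂ * (ε + v N) / (ε + v (N + 1)) := by positivity
        have h3 := Real.log_le_sub_one_of_pos h2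
        rw [Real.log_div (by positivity) (by positivity),
          Real.log_mul (by positivity) (by positivity)] at h3
        have h4 : g N ^ 2 / (ε + v (N + 1)) ≤ 1 - β₂ * (ε + v N) / (ε + v (N + 1)) := by
          rw [le_sub_iff_add_le, ← add_div, div_le_one (by positivity), hv]
          nlinarith
        linarith
      rw [Finset.sum_range_succ, Real.log_div (by positivity) (by positivity)]
      rw [Real.log_div (by positivity) (by positivity)] at ih
      push_cast
      linarith
  refine key.trans (sub_le_sub_right (Real.log_le_log ?_ ?_) _)
  · have := hvn N
    positivity
  · rw [add_div, div_self hε.ne', ← div_div]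
    gcongr
    exact decayed_sq_le_div hβ₂.le hβ₂1 hv0 hv hg N

theorem sq_momentum_le (hβ₁ : 0 ≤ β₁) (hβ₁1 : β₁ < 1) (hm0 : m 0 = 0)
    (hm : ∀ n, m (n + 1) = β₁ * m n + g n) (n : ℕ) :
    m (n + 1) ^ 2 ≤ 1 / (1 - β₁) * ∑ j ∈ Finset.range (n + 1), β₁ ^ (n - j) * g j ^ 2 := by
  rw [decayed_sum_eq hm0 hm, Nat.add_sub_cancel]
  have h := Finset.sum_sq_le_sum_mul_sum_of_sq_le_mul (Finset.range (n + 1))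
    (r := fun j => β₁ ^ (n - j) * g j) (f := fun j => β₁ ^ (n - j))
    (g := fun j => β₁ ^ (n - j) * g j ^ 2) (fun j _ => by positivity) (fun j _ => by positivity)
    (fun j _ => le_of_eq (by ring))
  refine h.trans (mul_le_mul_of_nonneg_right ?_ (Finset.sum_nonneg fun j _ => by positivity))
  refine le_of_eq_of_le ?_ (sum_range_pow_le hβ₁ hβ₁1 (n + 1))
  simpa using Finset.sum_range_reflect (fun k => β₁ ^ k) (n + 1)

/-- The normalized squared momenta are controlled by the normalized squared gradients. -/
theorem sum_sq_momentum_div_le (hβ₁ : 0 ≤ β₁) (hβ₁₂ : β₁ < β₂) (hβ₂1 : β₂ < 1) (hε : 0 < ε)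
    (hm0 : m 0 = 0) (hm : ∀ n, m (n + 1) = β₁ * m n + g n) (hv0 : v 0 = 0)
    (hv : ∀ n, v (n + 1) = β₂ * v n + g n ^ 2) (N : ℕ) :
    ∑ n ∈ Finset.range N, m (n + 1) ^ 2 / (ε + v (n + 1))
      ≤ 1 / ((1 - β₁) * (1 - β₁ / β₂))
        * ∑ n ∈ Finset.range N, g n ^ 2 / (ε + v (n + 1)) := by
  have hβ₂ : 0 < β₂ := hβ₁.trans_lt hβ₁₂
  have hq : β₁ / β₂ < 1 := (div_lt_one hβ₂).2 hβ₁₂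
  have hq0 : 0 ≤ β₁ / β₂ := by positivity
  have h1 : 0 < 1 - β₁ := by linarith
  have hvn := decayed_sq_nonneg hβ₂.le hv0 hv
  have hU : ∀ n, 0 ≤ g n ^ 2 / (ε + v (n + 1)) := fun n => by have := hvn (n + 1); positivity
  calc ∑ n ∈ Finset.range N, m (n + 1) ^ 2 / (ε + v (n + 1))
      ≤ ∑ n ∈ Finset.range N, 1 / (1 - β₁) * ∑ j ∈ Finset.range (n + 1),
          (β₁ / β₂) ^ (n - j) * (g j ^ 2 / (ε + v (j + 1))) := by
        refine Finset.sum_le_sum fun n _ => ?_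
        have hp := hvn (n + 1)
        calc m (n + 1) ^ 2 / (ε + v (n + 1))
            ≤ (1 / (1 - β₁) * ∑ j ∈ Finset.range (n + 1), β₁ ^ (n - j) * g j ^ 2)
              / (ε + v (n + 1)) := by
              gcongr
              exact sq_momentum_le hβ₁ (hβ₁₂.trans hβ₂1) hm0 hm n
          _ = 1 / (1 - β₁) * ∑ j ∈ Finset.range (n + 1),
              β₁ ^ (n - j) * (g j ^ 2 / (ε + v (n + 1))) := by
              rw [mul_div_assoc, Finset.sum_div]
              simp only [mul_div_assoc]
          _ ≤ _ := by
              refine mul_le_mul_of_nonneg_left (Finset.sum_le_sum fun j hj => ?_) (by positivity)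
              rw [div_pow, div_eq_mul_inv (β₁ ^ (n - j)), mul_assoc]
              gcongr
              exact sq_div_add_decayed_sq_le hβ₂ hβ₂1 hε hv0 hv
                (Nat.lt_succ_iff.1 (Finset.mem_range.1 hj))
    _ ≤ 1 / (1 - β₁) * (1 / (1 - β₁ / β₂) * ∑ n ∈ Finset.range N, g n ^ 2 / (ε + v (n + 1))) := by
        rw [← Finset.mul_sum]
        refine mul_le_mul_of_nonneg_left ?_ (by positivity)
        refine (sum_range_convolution_le (fun k => pow_nonneg hq0 k) hU N).trans ?_
        exact mul_le_mul_of_nonneg_right (sum_range_pow_le hq0 hq N)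
          (Finset.sum_nonneg fun n _ => hU n)
    _ = _ := by rw [← mul_assoc, one_div_mul_one_div]

end Scalar

/-! ### Estimates along one trajectory -/

open scoped InnerProductSpace in
/-- The descent lemma for a function with Lipschitz gradient. -/
theorem apply_add_le_of_lipschitz_gradient {E : Type*} [NormedAddCommGroup E]
    [InnerProductSpace ℝ E] [CompleteSpace E] {F : E → ℝ} (hF : Differentiable ℝ F) {L : ℝ}
    (hL : ∀ x y, ‖gradient F x - gradient F y‖ ≤ L * ‖x - y‖) (x h : E) :
    F (x + h) ≤ F x + ⟪gradient F x, h⟫_ℝ + L / 2 * ‖h‖ ^ 2 := by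
  set φ : ℝ → ℝ := fun t => F (x + t • h) - t * ⟪gradient F x, h⟫_ℝ - L / 2 * t ^ 2 * ‖h‖ ^ 2
  have hφ : ∀ t, HasDerivAt φ
      (⟪gradient F (x + t • h), h⟫_ℝ - ⟪gradient F x, h⟫_ℝ - L * t * ‖h‖ ^ 2) t := by
    intro t
    have h1 : HasDerivAt (fun t : ℝ => x + t • h) h t := by
      simpa using ((hasDerivAt_id t).smul_const h).const_add x
    have h2 := (hF (x + t • h)).hasFDerivAt.comp_hasDerivAt t h1
    rw [← inner_gradient_left] at h2
    have h3 := (hasDerivAt_id t).mul_const ⟪gradient F x, h⟫_ℝ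
    have h4 := (((hasDerivAt_id t).pow 2).const_mul (L / 2)).mul_const (‖h‖ ^ 2)
    refine ((h2.sub h3).sub h4).congr_deriv ?_
    simp only [id_eq, Nat.cast_ofNat, Nat.add_one_sub_one, pow_one]
    ring
  have hanti : AntitoneOn φ (Set.Icc 0 1) := by
    refine antitoneOn_of_deriv_nonpos (convex_Icc 0 1)
      (fun t _ => (hφ t).continuousAt.continuousWithinAt)
      (fun t _ => (hφ t).differentiableAt.differentiableWithinAt) fun t ht => ?_
    rw [interior_Icc] at ht
    rw [(hφ t).deriv, ← inner_sub_left, sub_nonpos]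
    calc ⟪gradient F (x + t • h) - gradient F x, h⟫_ℝ
        ≤ ‖gradient F (x + t • h) - gradient F x‖ * ‖h‖ := real_inner_le_norm _ _
      _ ≤ (L * ‖x + t • h - x‖) * ‖h‖ := by gcongr; exact hL _ _
      _ = L * t * ‖h‖ ^ 2 := by
          rw [add_sub_cancel_left, norm_smul, Real.norm_eq_abs, abs_of_pos ht.1]
          ring
  have h01 := hanti (Set.left_mem_Icc.2 zero_le_one) (Set.right_mem_Icc.2 zero_le_one) zero_le_one
  simp only [φ, one_smul, zero_smul, add_zero, one_mul, zero_mul, one_pow, mul_one,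
    ne_eq, OfNat.ofNat_ne_zero, not_false_eq_true, zero_pow, mul_zero, sub_zero] at h01
  linarith

theorem continuous_gradient_of_lipschitz {E : Type*} [NormedAddCommGroup E]
    [InnerProductSpace ℝ E] [CompleteSpace E] {F : E → ℝ} {L : ℝ} (hL0 : 0 ≤ L)
    (hL : ∀ x y, ‖gradient F x - gradient F y‖ ≤ L * ‖x - y‖) : Continuous (gradient F) :=
  (LipschitzWith.of_dist_le_mul (K := ⟨L, hL0⟩) fun x y => by
    rw [dist_eq_norm, dist_eq_norm]
    exact hL x y).continuous

section Pathwise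

variable {d : ℕ} {F : EuclideanSpace ℝ (Fin d) → ℝ} {x m v g : ℕ → EuclideanSpace ℝ (Fin d)}
  {a : ℕ → ℝ} {A L R ε β₁ β₂ Fstar : ℝ}

theorem norm_sq_sub_iterate_le {u : ℕ → EuclideanSpace ℝ (Fin d)}
    (hx : ∀ n, x (n + 1) = x n - a n • u n) (ha0 : ∀ n, 0 ≤ a n) (haA : ∀ n, a n ≤ A)
    {j n : ℕ} (hjn : j ≤ n) :
    ‖x n - x j‖ ^ 2 ≤ A ^ 2 * (((n - j : ℕ) : ℝ) * ∑ l ∈ Finset.Ico j n, ‖u l‖ ^ 2) := by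
  have hA : 0 ≤ A := (ha0 0).trans (haA 0)
  have h1 : ‖x n - x j‖ ≤ ∑ l ∈ Finset.Ico j n, A * ‖u l‖ := by
    induction n, hjn using Nat.le_induction with
    | base => simp
    | succ n hjn ih =>
      rw [Finset.sum_Ico_succ_top hjn, hx]
      calc ‖x n - a n • u n - x j‖ = ‖(x n - x j) - a n • u n‖ := by congr 1; abel
        _ ≤ ‖x n - x j‖ + ‖a n • u n‖ := norm_sub_le _ _
        _ ≤ _ := by
          rw [norm_smul, Real.norm_eq_abs, abs_of_nonneg (ha0 n)]
          gcongr
          exact haA n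
  rw [← Finset.mul_sum] at h1
  calc ‖x n - x j‖ ^ 2 ≤ (A * ∑ l ∈ Finset.Ico j n, ‖u l‖) ^ 2 := by gcongr
    _ = A ^ 2 * (∑ l ∈ Finset.Ico j n, ‖u l‖) ^ 2 := by ring
    _ ≤ _ := by
      gcongr
      simpa using sq_sum_le_card_mul_sum_sq (s := Finset.Ico j n) (f := fun l => ‖u l‖)

/-- Comparison of the momentum direction at iteration `n` with the past gradients `G j`: the
error of replacing `G n` by `G j` in front of `g j` is split by Young's inequality, with a weight
that decreases in the delay `n - j`. -/
theorem le_sum_mul_momentum_div (hβ₁ : 0 ≤ β₁) (hβ₁1 : β₁ < 1) (hR : 0 < R) (hε : 0 < ε)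
    (hm0 : m 0 = 0) (hm : ∀ n i, m (n + 1) i = β₁ * m n i + g n i)
    (hv : ∀ n i, 0 ≤ v n i) (G : ℕ → EuclideanSpace ℝ (Fin d)) (n : ℕ) :
    ∑ j ∈ Finset.range (n + 1), β₁ ^ (n - j) * ∑ i, G j i * g j i / √(ε + v (n + 1) i)
      ≤ ∑ i, G n i * (m (n + 1) i / √(ε + v (n + 1) i))
        + ∑ j ∈ Finset.range (n + 1), β₁ ^ (n - j)
          * (√(1 - β₁) / (4 * R * √((n - j : ℕ) + 1)) * ‖G n - G j‖ ^ 2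
            + R * √((n - j : ℕ) + 1) / √(1 - β₁) * ∑ i, g j i ^ 2 / (ε + v (n + 1) i)) := by
  have hs : 0 < √(1 - β₁) := Real.sqrt_pos.2 (sub_pos.2 hβ₁1)
  have hm' : ∀ i, m (n + 1) i = ∑ j ∈ Finset.range (n + 1), β₁ ^ (n - j) * g j i := fun i => by
    have := decayed_sum_eq (β := β₁) (m := fun n => m n i) (g := fun n => g n i) (by simp [hm0])
      (fun n => hm n i) (n + 1)
    simpa using this
  have h1 : ∑ i, G n i * (m (n + 1) i / √(ε + v (n + 1) i))
      = ∑ j ∈ Finset.range (n + 1), β₁ ^ (n - j)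
        * ∑ i, G n i * g j i / √(ε + v (n + 1) i) := by
    simp only [Finset.mul_sum]
    rw [Finset.sum_comm]
    refine Finset.sum_congr rfl fun i _ => ?_
    rw [hm', Finset.sum_div, Finset.mul_sum]
    refine Finset.sum_congr rfl fun j _ => ?_
    ring
  rw [h1, ← Finset.sum_add_distrib]
  refine Finset.sum_le_sum fun j _ => ?_
  rw [← mul_add]
  refine mul_le_mul_of_nonneg_left ?_ (by positivity)
  set k : ℝ := √((n - j : ℕ) + 1)
  have hk : 0 < k := Real.sqrt_pos.2 (by positivity)
  rw [EuclideanSpace.real_norm_sq_eq, Finset.mul_sum, Finset.mul_sum, ← Finset.sum_add_distrib,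
    ← Finset.sum_add_distrib]
  refine Finset.sum_le_sum fun i _ => ?_
  have hp : 0 < ε + v (n + 1) i := by have := hv (n + 1) i; positivity
  have hp' := Real.sqrt_pos.2 hp
  rw [PiLp.sub_apply]
  set p := √(ε + v (n + 1) i)
  have hpp : ε + v (n + 1) i = p ^ 2 := (Real.sq_sqrt hp.le).symm
  rw [hpp]
  set s := √(1 - β₁)
  -- `c / 4 * a ^ 2 + b ^ 2 / c + a * b` is a square for `c = s / (R * k)`
  have h2 : s / (4 * R * k) * (G n i - G j i) ^ 2 + R * k / s * (g j i ^ 2 / p ^ 2)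
      - (G j i - G n i) * g j i / p
      = R * k / s * (s / (2 * R * k) * (G n i - G j i) + g j i / p) ^ 2 := by
    field_simp
    ring
  have h3 : 0 ≤ R * k / s * (s / (2 * R * k) * (G n i - G j i) + g j i / p) ^ 2 := by positivity
  have h4 : (G j i - G n i) * g j i / p = G j i * g j i / p - G n i * g j i / p := by ring
  linarith

/-- The estimate along one trajectory: summing the descent lemma over the iterations controls the
products of each past gradient `∇F (x j)` with its stochastic estimate `g j`. -/
theorem sum_mul_div_sqrt_le (hF : Differentiable ℝ F) (hL0 : 0 ≤ L)
    (hL : ∀ x y, ‖gradient F x - gradient F y‖ ≤ L * ‖x - y‖) (hFstar : ∀ x, Fstar ≤ F x)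
    (hβ₁ : 0 ≤ β₁) (hβ₁1 : β₁ < 1) (hR : 0 < R) (hε : 0 < ε)
    (hm0 : m 0 = 0) (hm : ∀ n i, m (n + 1) i = β₁ * m n i + g n i) (hv : ∀ n i, 0 ≤ v n i)
    (hx : ∀ n i, x (n + 1) i = x n i - a n * (m (n + 1) i / √(ε + v (n + 1) i)))
    (ha0 : ∀ n, 0 ≤ a n) (haA : ∀ n, a n ≤ A) (N : ℕ) :
    ∑ n ∈ Finset.range N, a n * ∑ j ∈ Finset.range (n + 1), β₁ ^ (n - j)
        * ∑ i, gradient F (x j) i * g j i / √(ε + v (n + 1) i)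
      ≤ F (x 0) - Fstar
        + (L * A ^ 2 / 2 + A ^ 3 * L ^ 2 * β₁ / (R * (1 - β₁) ^ 2))
          * ∑ n ∈ Finset.range N, ∑ i, m (n + 1) i ^ 2 / (ε + v (n + 1) i)
        + A * R / √(1 - β₁) * ∑ n ∈ Finset.range N, ∑ j ∈ Finset.range (n + 1),
          β₁ ^ (n - j) * √((n - j : ℕ) + 1) * ∑ i, g j i ^ 2 / (ε + v (n + 1) i) := by
  have hA : 0 ≤ A := (ha0 0).trans (haA 0)
  have hs : 0 < √(1 - β₁) := Real.sqrt_pos.2 (sub_pos.2 hβ₁1)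
  have hb : 0 < 1 - β₁ := sub_pos.2 hβ₁1
  set u : ℕ → EuclideanSpace ℝ (Fin d) :=
    fun n => WithLp.toLp 2 fun i => m (n + 1) i / √(ε + v (n + 1) i) with hu
  have hp : ∀ n i, 0 < ε + v n i := fun n i => by have := hv n i; positivity
  have hxu : ∀ n, x (n + 1) = x n - a n • u n := fun n => by
    ext i
    simp [hu, hx]
  have hun : ∀ n, ‖u n‖ ^ 2 = ∑ i, m (n + 1) i ^ 2 / (ε + v (n + 1) i) := fun n => by
    rw [EuclideanSpace.real_norm_sq_eq]
    refine Finset.sum_congr rfl fun i _ => ?_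
    simp only [hu]
    rw [div_pow, Real.sq_sqrt (hp _ _).le]
  simp only [← hun]
  -- one step of the descent lemma, with the momentum expanded
  have hstep : ∀ n, a n * ∑ j ∈ Finset.range (n + 1), β₁ ^ (n - j)
        * ∑ i, gradient F (x j) i * g j i / √(ε + v (n + 1) i)
      ≤ F (x n) - F (x (n + 1)) + L * A ^ 2 / 2 * ‖u n‖ ^ 2
        + (A ^ 3 * L ^ 2 * √(1 - β₁) / (4 * R)) * ∑ j ∈ Finset.range (n + 1),
          β₁ ^ (n - j) * (((n - j : ℕ) : ℝ) / √((n - j : ℕ) + 1)) * ∑ l ∈ Finset.Ico j n, ‖u l‖ ^ 2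
        + A * R / √(1 - β₁) * ∑ j ∈ Finset.range (n + 1), β₁ ^ (n - j) * √((n - j : ℕ) + 1)
          * ∑ i, g j i ^ 2 / (ε + v (n + 1) i) := by
    intro n
    have h1 := apply_add_le_of_lipschitz_gradient hF hL (x n) (-(a n • u n))
    rw [← sub_eq_add_neg, ← hxu, inner_neg_right, real_inner_smul_right, norm_neg, norm_smul,
      Real.norm_eq_abs, abs_of_nonneg (ha0 n), mul_pow] at h1
    have h2 : inner ℝ (gradient F (x n)) (u n)
        = ∑ i, gradient F (x n) i * (m (n + 1) i / √(ε + v (n + 1) i)) := by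
      rw [PiLp.inner_apply]
      refine Finset.sum_congr rfl fun i _ => ?_
      simp [hu, mul_comm]
    rw [h2] at h1
    have h3 := mul_le_mul_of_nonneg_left (le_sum_mul_momentum_div hβ₁ hβ₁1 hR hε hm0 hm hv
      (fun n => gradient F (x n)) n) (ha0 n)
    have h4 : L / 2 * (a n ^ 2 * ‖u n‖ ^ 2) ≤ L * A ^ 2 / 2 * ‖u n‖ ^ 2 := by
      have : a n ^ 2 ≤ A ^ 2 := pow_le_pow_left₀ (ha0 n) (haA n) 2
      calc L / 2 * (a n ^ 2 * ‖u n‖ ^ 2) ≤ L / 2 * (A ^ 2 * ‖u n‖ ^ 2) := by gcongr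
        _ = _ := by ring
    have h5 : a n * ∑ j ∈ Finset.range (n + 1), β₁ ^ (n - j)
          * (√(1 - β₁) / (4 * R * √((n - j : ℕ) + 1)) * ‖gradient F (x n) - gradient F (x j)‖ ^ 2
            + R * √((n - j : ℕ) + 1) / √(1 - β₁) * ∑ i, g j i ^ 2 / (ε + v (n + 1) i))
        ≤ (A ^ 3 * L ^ 2 * √(1 - β₁) / (4 * R)) * ∑ j ∈ Finset.range (n + 1),
          β₁ ^ (n - j) * (((n - j : ℕ) : ℝ) / √((n - j : ℕ) + 1)) * ∑ l ∈ Finset.Ico j n, ‖u l‖ ^ 2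
        + A * R / √(1 - β₁) * ∑ j ∈ Finset.range (n + 1), β₁ ^ (n - j) * √((n - j : ℕ) + 1)
          * ∑ i, g j i ^ 2 / (ε + v (n + 1) i) := by
      rw [Finset.mul_sum, Finset.mul_sum, Finset.mul_sum, ← Finset.sum_add_distrib]
      refine Finset.sum_le_sum fun j hj => ?_
      have hjn : j ≤ n := Nat.lt_succ_iff.1 (Finset.mem_range.1 hj)
      have hG : ‖gradient F (x n) - gradient F (x j)‖ ^ 2
          ≤ L ^ 2 * (A ^ 2 * (((n - j : ℕ) : ℝ) * ∑ l ∈ Finset.Ico j n, ‖u l‖ ^ 2)) := by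
        calc ‖gradient F (x n) - gradient F (x j)‖ ^ 2 ≤ (L * ‖x n - x j‖) ^ 2 := by
              gcongr; exact hL _ _
          _ = L ^ 2 * ‖x n - x j‖ ^ 2 := by ring
          _ ≤ _ := by gcongr; exact norm_sq_sub_iterate_le hxu ha0 haA hjn
      have hW : 0 ≤ ∑ i, g j i ^ 2 / (ε + v (n + 1) i) :=
        Finset.sum_nonneg fun i _ => by have := hp (n + 1) i; positivity
      have hk : 0 < √(((n - j : ℕ) : ℝ) + 1) := Real.sqrt_pos.2 (by positivity)
      calc a n * (β₁ ^ (n - j)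
            * (√(1 - β₁) / (4 * R * √((n - j : ℕ) + 1)) * ‖gradient F (x n) - gradient F (x j)‖ ^ 2
            + R * √((n - j : ℕ) + 1) / √(1 - β₁) * ∑ i, g j i ^ 2 / (ε + v (n + 1) i)))
          ≤ A * (β₁ ^ (n - j)
            * (√(1 - β₁) / (4 * R * √((n - j : ℕ) + 1))
              * (L ^ 2 * (A ^ 2 * (((n - j : ℕ) : ℝ) * ∑ l ∈ Finset.Ico j n, ‖u l‖ ^ 2)))
            + R * √((n - j : ℕ) + 1) / √(1 - β₁) * ∑ i, g j i ^ 2 / (ε + v (n + 1) i))) := by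
            gcongr
            exact haA n
        _ = _ := by
            field_simp
    rw [mul_add] at h3
    linarith
  refine (Finset.sum_le_sum fun n _ => hstep n).trans ?_
  rw [Finset.sum_add_distrib, Finset.sum_add_distrib, Finset.sum_add_distrib,
    Finset.sum_range_sub', ← Finset.mul_sum, ← Finset.mul_sum, ← Finset.mul_sum, add_mul]
  have hwin := sum_range_window_le (c := fun k : ℕ => β₁ ^ k * (k / √((k : ℝ) + 1)))
    (b := fun l => ‖u l‖ ^ 2) (fun k => by positivity) (fun l => by positivity) N
  have hT : 0 ≤ ∑ l ∈ Finset.range N, ‖u l‖ ^ 2 := Finset.sum_nonneg fun _ _ => sq_nonneg _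
  have h6 : (A ^ 3 * L ^ 2 * √(1 - β₁) / (4 * R)) * ∑ n ∈ Finset.range N,
        ∑ j ∈ Finset.range (n + 1),
          β₁ ^ (n - j) * (((n - j : ℕ) : ℝ) / √((n - j : ℕ) + 1)) * ∑ l ∈ Finset.Ico j n, ‖u l‖ ^ 2
      ≤ A ^ 3 * L ^ 2 * β₁ / (R * (1 - β₁) ^ 2) * ∑ n ∈ Finset.range N, ‖u n‖ ^ 2 := by
    calc _ ≤ (A ^ 3 * L ^ 2 * √(1 - β₁) / (4 * R)) * (4 * β₁ / ((1 - β₁) ^ 2 * √(1 - β₁))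
          * ∑ n ∈ Finset.range N, ‖u n‖ ^ 2) := by
          refine mul_le_mul_of_nonneg_left (hwin.trans ?_) (by positivity)
          exact mul_le_mul_of_nonneg_right (sum_range_pow_mul_sq_div_sqrt_le hβ₁ hβ₁1 N) hT
      _ = _ := by
          field_simp
  have h7 := hFstar (x N)
  linarith

/-- The sum of the delayed normalized squared gradients is dominated by the undelayed one. -/
theorem sum_delayed_sq_div_le (hβ₁ : 0 ≤ β₁) (hβ₁₂ : β₁ < β₂) (hβ₂1 : β₂ < 1) (hε : 0 < ε)
    (hv0 : v 0 = 0) (hv : ∀ n i, v (n + 1) i = β₂ * v n i + g n i ^ 2) (N : ℕ) :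
    ∑ n ∈ Finset.range N, ∑ j ∈ Finset.range (n + 1),
          β₁ ^ (n - j) * √((n - j : ℕ) + 1) * ∑ i, g j i ^ 2 / (ε + v (n + 1) i)
      ≤ 1 / ((1 - β₁ / β₂) * √(1 - β₁ / β₂))
        * ∑ n ∈ Finset.range N, ∑ i, g n i ^ 2 / (ε + v (n + 1) i) := by
  have hβ₂ : 0 < β₂ := hβ₁.trans_lt hβ₁₂
  have hq : β₁ / β₂ < 1 := (div_lt_one hβ₂).2 hβ₁₂
  have hq0 : 0 ≤ β₁ / β₂ := by positivity
  have hvn : ∀ n i, 0 ≤ v n i := fun n i => decayed_sq_nonneg (v := fun n => v n i)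
    (g := fun n => g n i) hβ₂.le (by simp [hv0]) (fun n => hv n i) n
  have hU : ∀ n, 0 ≤ ∑ i, g n i ^ 2 / (ε + v (n + 1) i) := fun n =>
    Finset.sum_nonneg fun i _ => by have := hvn (n + 1) i; positivity
  have hconv := sum_range_convolution_le (c := fun k : ℕ => (β₁ / β₂) ^ k * √((k : ℝ) + 1))
    (b := fun n => ∑ i, g n i ^ 2 / (ε + v (n + 1) i)) (fun k => by positivity) hU N
  refine le_trans (Finset.sum_le_sum fun n _ => Finset.sum_le_sum fun j hj => ?_)
    (hconv.trans (mul_le_mul_of_nonneg_right (sum_range_pow_mul_sqrt_succ_le hq0 hq N)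
      (Finset.sum_nonneg fun n _ => hU n)))
  have hjn : j ≤ n := Nat.lt_succ_iff.1 (Finset.mem_range.1 hj)
  rw [Finset.mul_sum, Finset.mul_sum]
  refine Finset.sum_le_sum fun i _ => ?_
  have h := sq_div_add_decayed_sq_le (v := fun n => v n i) (g := fun n => g n i) hβ₂ hβ₂1 hε
    (by simp [hv0]) (fun n => hv n i) hjn
  calc _ ≤ β₁ ^ (n - j) * √((n - j : ℕ) + 1)
        * ((β₂ ^ (n - j))⁻¹ * (g j i ^ 2 / (ε + v (j + 1) i))) := by gcongr
    _ = _ := by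
      rw [div_pow]
      ring

end Pathwise

/-! ### Correlation with a random denominator -/

/-- The pointwise comparison of `G * g / √P` with its decorrelated version `G * g / √V`, where
`V` and `P` differ by `ρ - δ`. The numbers `ρ` and `δ` stand for the contribution of the most
recent squared gradients to the denominator, conditionally averaged and raw. -/
theorem mul_div_sqrt_sub_le {G g c ρ δ K ε η : ℝ} (hε : 0 < ε) (hc : ε ≤ c) (hρ : 0 ≤ ρ)
    (hδ : 0 ≤ δ) (hK : 0 ≤ K) (hρK : ρ ≤ K ^ 2) (hη : 0 < η) :
    G / √(c + ρ) * g - 1 / 4 * (G ^ 2 / √(c + ρ)) - G ^ 2 / (4 * (ρ + η) * √(c + ρ)) * δ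
        - (2 * K + η / √ε) * (g ^ 2 / (c + δ))
      ≤ G * g / √(c + δ) := by
  have hc0 : 0 < c := hε.trans_le hc
  set a := √(c + δ) with ha_def
  set b := √(c + ρ) with hb_def
  have ha : 0 < a := Real.sqrt_pos.2 (by positivity)
  have hb : 0 < b := Real.sqrt_pos.2 (by positivity)
  have haa : a ^ 2 = c + δ := Real.sq_sqrt (by positivity)
  have hbb : b ^ 2 = c + ρ := Real.sq_sqrt (by positivity)
  have hse : 0 < √ε := Real.sqrt_pos.2 hε
  have hεb : √ε ≤ b := Real.sqrt_le_sqrt (by linarith)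
  rw [← haa]
  have hρb2 : ρ ≤ b ^ 2 := by linarith
  have hδa2 : δ ≤ a ^ 2 := by linarith
  have hρb : ρ ≤ b * K := by
    refine le_of_sq_le_sq ?_ (by positivity)
    calc ρ ^ 2 = ρ * ρ := sq ρ
      _ ≤ b ^ 2 * K ^ 2 := by gcongr
      _ = (b * K) ^ 2 := by ring
  have hdiff : G / b * g - G * g / a = G * g * (δ - ρ) / (a * b * (a + b)) := by
    have : δ - ρ = (a - b) * (a + b) := by linear_combination hbb - haa
    rw [this]
    field_simp
  have habs : G * g * (δ - ρ) / (a * b * (a + b))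
      ≤ |G| * |g| * ρ / (a * b ^ 2) + |G| * |g| * δ / (a ^ 2 * b) := by
    have h1 : G * g * (δ - ρ) ≤ |G| * |g| * ρ + |G| * |g| * δ := by
      rw [← mul_add, ← abs_mul]
      calc G * g * (δ - ρ) ≤ |G * g * (δ - ρ)| := le_abs_self _
        _ = |G * g| * |δ - ρ| := abs_mul _ _
        _ ≤ |G * g| * (ρ + δ) := by
          gcongr
          rw [abs_le]
          constructor <;> linarith
    calc G * g * (δ - ρ) / (a * b * (a + b))
        ≤ (|G| * |g| * ρ + |G| * |g| * δ) / (a * b * (a + b)) := by gcongr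
      _ = |G| * |g| * ρ / (a * b * (a + b)) + |G| * |g| * δ / (a * b * (a + b)) := add_div _ _ _
      _ ≤ |G| * |g| * ρ / (a * b * b) + |G| * |g| * δ / (a * b * a) := by
        gcongr <;> linarith
      _ = _ := by ring
  have hκ : |G| * |g| * ρ / (a * b ^ 2) ≤ 1 / 4 * (G ^ 2 / b) + K * (g ^ 2 / a ^ 2) := by
    have h1 : 0 ≤ b * (|G| / (2 * b) - ρ * |g| / (a * b ^ 2)) ^ 2 := by positivity
    have h2 : b * (|G| / (2 * b) - ρ * |g| / (a * b ^ 2)) ^ 2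
        = 1 / 4 * (|G| ^ 2 / b) - |G| * |g| * ρ / (a * b ^ 2)
          + ρ ^ 2 / b ^ 3 * (|g| ^ 2 / a ^ 2) := by
      field_simp
      ring
    have h3 : ρ ^ 2 / b ^ 3 ≤ K := by
      rw [div_le_iff₀ (by positivity)]
      calc ρ ^ 2 = ρ * ρ := sq ρ
        _ ≤ b ^ 2 * (b * K) := by gcongr
        _ = K * b ^ 3 := by ring
    have h4 : ρ ^ 2 / b ^ 3 * (|g| ^ 2 / a ^ 2) ≤ K * (|g| ^ 2 / a ^ 2) := by gcongr
    rw [sq_abs] at h2 h4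
    rw [sq_abs] at h2
    linarith
  have hρ' : |G| * |g| * δ / (a ^ 2 * b)
      ≤ G ^ 2 / (4 * (ρ + η) * b) * δ + (K + η / √ε) * (g ^ 2 / a ^ 2) := by
    have hρη : 0 < ρ + η := by positivity
    have h1 : 0 ≤ δ * (ρ + η) / b * (|G| / (2 * (ρ + η)) - |g| / a ^ 2) ^ 2 := by positivity
    have h2 : δ * (ρ + η) / b * (|G| / (2 * (ρ + η)) - |g| / a ^ 2) ^ 2
        = |G| ^ 2 / (4 * (ρ + η) * b) * δ - |G| * |g| * δ / (a ^ 2 * b)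
          + (ρ + η) / b * (δ / a ^ 2) * (|g| ^ 2 / a ^ 2) := by
      field_simp
      ring
    have h3 : (ρ + η) / b * (δ / a ^ 2) ≤ K + η / √ε := by
      calc (ρ + η) / b * (δ / a ^ 2) ≤ (ρ + η) / b * 1 := by
            gcongr
            exact (div_le_one (by positivity)).2 hδa2
        _ = ρ / b + η / b := by ring
        _ ≤ K + η / √ε := by
            gcongr
            rw [div_le_iff₀ hb]
            linarith
    have h4 : (ρ + η) / b * (δ / a ^ 2) * (|g| ^ 2 / a ^ 2)
        ≤ (K + η / √ε) * (|g| ^ 2 / a ^ 2) := by gcongr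
    rw [sq_abs] at h2 h4
    rw [sq_abs] at h2
    linarith
  linarith

section Conditional

variable {Ω : Type*} {m m0 : MeasurableSpace Ω} {μ : Measure Ω} [IsProbabilityMeasure μ]

theorem integral_mul_condExp_of_bounded (hm : m ≤ m0) {φ h : Ω → ℝ} {C : ℝ}
    (hφ : StronglyMeasurable[m] φ) (hC : ∀ ω, |φ ω| ≤ C) (hh : Integrable h μ) :
    ∫ ω, φ ω * h ω ∂μ = ∫ ω, φ ω * (μ[h|m]) ω ∂μ := by
  have hint : Integrable (φ * h) μ :=
    hh.bdd_mul (hφ.mono hm).aestronglyMeasurable (Filter.Eventually.of_forall hC)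
  exact (integral_condExp hm (f := φ * h)).symm.trans
    (integral_congr_ae (condExp_mul_of_stronglyMeasurable_left hφ hint hh))

/-- The correlation between the normalized stochastic gradient `g / √(ε + w + δ)` and its
conditional mean `G` is bounded below, although the random part `δ` of the denominator is not
independent of `g`: replacing `δ` by its conditional mean costs half of the main term and a
multiple of `𝔼[g² / (ε + w + δ)]`. -/
theorem le_integral_mul_div_sqrt (hm : m ≤ m0) {G g w δ : Ω → ℝ} {B K M ε : ℝ}
    (hε : 0 < ε) (hK : 0 ≤ K) (hM : 0 < M)
    (hG : StronglyMeasurable[m] G) (hGB : ∀ ω, |G ω| ≤ B)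
    (hg : AEStronglyMeasurable[m0] g μ) (hgB : ∀ᵐ ω ∂μ, |g ω| ≤ B) (hgG : μ[g|m] =ᵐ[μ] G)
    (hw : StronglyMeasurable[m] w) (hw0 : ∀ ω, 0 ≤ w ω)
    (hδ : AEStronglyMeasurable[m0] δ μ) (hδ0 : ∀ ω, 0 ≤ δ ω) (hδK : ∀ᵐ ω ∂μ, δ ω ≤ K ^ 2)
    (hPM : ∀ᵐ ω ∂μ, ε + w ω + δ ω ≤ M ^ 2) :
    1 / (2 * M) * ∫ ω, G ω ^ 2 ∂μ - 2 * K * ∫ ω, g ω ^ 2 / (ε + w ω + δ ω) ∂μ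
      ≤ ∫ ω, G ω * g ω / √(ε + w ω + δ ω) ∂μ := by
  have hse : 0 < √ε := Real.sqrt_pos.2 hε
  have hδint : Integrable δ μ := Integrable.of_bound hδ (K ^ 2) (by
    filter_upwards [hδK] with ω h
    rwa [Real.norm_eq_abs, abs_of_nonneg (hδ0 ω)])
  have hgint : Integrable g μ := Integrable.of_bound hg B hgB
  -- the conditional mean of `δ`, in a version that is nonnegative everywhere
  set ρ : Ω → ℝ := fun ω => max 0 ((μ[δ|m]) ω) with hρ_def
  have hρm : StronglyMeasurable[m] ρ := 
    (measurable_const.max stronglyMeasurable_condExp.measurable).stronglyMeasurable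
  have hρ0 : ∀ ω, 0 ≤ ρ ω := fun ω => le_max_left _ _
  have hρae : μ[δ|m] =ᵐ[μ] ρ := by
    have h := condExp_nonneg (m := m) (μ := μ) (f := δ) (Filter.Eventually.of_forall hδ0)
    filter_upwards [h] with ω h
    exact (max_eq_right h).symm
  have hρK : ∀ᵐ ω ∂μ, ρ ω ≤ K ^ 2 := by
    have h := condExp_mono (m := m) hδint (integrable_const (K ^ 2)) hδK
    rw [condExp_const hm] at h
    filter_upwards [h] with ω h
    exact max_le (by positivity) h
  have hVM : ∀ᵐ ω ∂μ, ε + w ω + ρ ω ≤ M ^ 2 := by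
    have hwint : Integrable w μ := Integrable.of_bound (hw.mono hm).aestronglyMeasurable (M ^ 2) (by
      filter_upwards [hPM] with ω h
      rw [Real.norm_eq_abs, abs_of_nonneg (hw0 ω)]
      linarith [hδ0 ω])
    have h1 : δ ≤ᵐ[μ] fun ω => M ^ 2 - ε - w ω := by
      filter_upwards [hPM] with ω h
      linarith
    have h2 := condExp_mono (m := m) hδint ((integrable_const (M ^ 2 - ε)).sub hwint) h1
    rw [condExp_of_stronglyMeasurable hm (stronglyMeasurable_const.sub hw)
      ((integrable_const (M ^ 2 - ε)).sub hwint)] at h2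
    filter_upwards [h2, hρae] with ω h2 h3
    rw [← h3]
    simp only [Pi.sub_apply] at h2
    linarith
  have hc : ∀ ω, ε ≤ ε + w ω := fun ω => le_add_of_nonneg_right (hw0 ω)
  have hV : ∀ ω, √ε ≤ √(ε + w ω + ρ ω) := fun ω =>
    Real.sqrt_le_sqrt (by linarith [hw0 ω, hρ0 ω])
  have hP : ∀ ω, ε ≤ ε + w ω + δ ω := fun ω => by linarith [hw0 ω, hδ0 ω]
  have hVpos : ∀ ω, 0 < √(ε + w ω + ρ ω) := fun ω => hse.trans_le (hV ω)
  have hB : 0 ≤ B := by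
    obtain ⟨ω⟩ := nonempty_of_isProbabilityMeasure μ
    exact (abs_nonneg _).trans (hGB ω)
  have hGsq : ∀ ω, G ω ^ 2 ≤ B ^ 2 := fun ω => sq_le_sq' (abs_le.1 (hGB ω)).1 (abs_le.1 (hGB ω)).2
  have hwm := hw.measurable
  have hGm := hG.measurable
  have hρm' := hρm.measurable
  have hVm : Measurable[m] fun ω => √(ε + w ω + ρ ω) :=
    ((measurable_const.add hwm).add hρm').sqrt
  have hPm : AEStronglyMeasurable[m0] (fun ω => ε + w ω + δ ω) μ :=
    (aestronglyMeasurable_const.add (hw.mono hm).aestronglyMeasurable).add hδ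
  have hGae : AEStronglyMeasurable[m0] G μ := (hG.mono hm).aestronglyMeasurable
  have hφ1 : StronglyMeasurable[m] fun ω => G ω / √(ε + w ω + ρ ω) :=
    (hGm.div hVm).stronglyMeasurable
  have hφ1B : ∀ ω, |G ω / √(ε + w ω + ρ ω)| ≤ B / √ε := fun ω => by
    rw [abs_div, abs_of_pos (hVpos ω)]
    exact div_le_div₀ hB (hGB ω) hse (hV ω)
  -- integrability
  have iGG : Integrable (fun ω => G ω ^ 2) μ := Integrable.of_bound (hGae.pow 2) (B ^ 2)
    (Filter.Eventually.of_forall fun ω => by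
      rw [Real.norm_eq_abs, abs_of_nonneg (sq_nonneg _)]
      exact hGsq ω)
  have iGV : Integrable (fun ω => G ω ^ 2 / √(ε + w ω + ρ ω)) μ :=
    Integrable.of_bound (((hGm.pow_const 2).div hVm).stronglyMeasurable.mono hm).aestronglyMeasurable
      (B ^ 2 / √ε) (Filter.Eventually.of_forall fun ω => by
      have := hVpos ω
      rw [Real.norm_eq_abs, abs_of_nonneg (by positivity)]
      exact div_le_div₀ (by positivity) (hGsq ω) hse (hV ω))
  have iU : Integrable (fun ω => g ω ^ 2 / (ε + w ω + δ ω)) μ :=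
    Integrable.of_bound ((hg.pow 2).div₀ hPm) (B ^ 2 / ε) (by
      filter_upwards [hgB] with ω h
      have := hε.trans_le (hP ω)
      rw [Real.norm_eq_abs, abs_of_nonneg (by positivity)]
      exact div_le_div₀ (by positivity) (sq_le_sq' (abs_le.1 h).1 (abs_le.1 h).2) hε (hP ω))
  have iGg : Integrable (fun ω => G ω * g ω / √(ε + w ω + δ ω)) μ :=
    Integrable.of_bound ((hGae.mul hg).div₀
      (Real.continuous_sqrt.comp_aestronglyMeasurable hPm)) (B * B / √ε) (by
      filter_upwards [hgB] with ω h
      have h1 : √ε ≤ √(ε + w ω + δ ω) := Real.sqrt_le_sqrt (hP ω)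
      rw [Real.norm_eq_abs, abs_div, abs_mul, abs_of_pos (hse.trans_le h1)]
      exact div_le_div₀ (by positivity) (mul_le_mul (hGB ω) h (abs_nonneg _) hB) hse h1)
  have i1 : Integrable (fun ω => G ω / √(ε + w ω + ρ ω) * g ω) μ :=
    hgint.bdd_mul (hφ1.mono hm).aestronglyMeasurable (Filter.Eventually.of_forall hφ1B)
  -- the main term
  have e1 : ∫ ω, G ω / √(ε + w ω + ρ ω) * g ω ∂μ = ∫ ω, G ω ^ 2 / √(ε + w ω + ρ ω) ∂μ := by
    rw [integral_mul_condExp_of_bounded hm hφ1 hφ1B hgint]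
    refine integral_congr_ae ?_
    filter_upwards [hgG] with ω h
    rw [h]
    ring
  have e3 : 1 / M * ∫ ω, G ω ^ 2 ∂μ ≤ ∫ ω, G ω ^ 2 / √(ε + w ω + ρ ω) ∂μ := by
    rw [← integral_const_mul]
    refine integral_mono_ae (iGG.const_mul _) iGV ?_
    filter_upwards [hVM] with ω h
    have h1 : √(ε + w ω + ρ ω) ≤ M := Real.sqrt_le_iff.2 ⟨hM.le, h⟩
    calc 1 / M * G ω ^ 2 = G ω ^ 2 / M := by ring
      _ ≤ _ := div_le_div_of_nonneg_left (sq_nonneg _) (hVpos ω) h1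
  have hU0 : 0 ≤ ∫ ω, g ω ^ 2 / (ε + w ω + δ ω) ∂μ := integral_nonneg fun ω => by
    have := hε.trans_le (hP ω)
    simp only [Pi.zero_apply]
    positivity
  -- `η` keeps the weight `1 / (ρ + η)` bounded and is sent to `0`
  have key : ∀ η > 0, 1 / (2 * M) * ∫ ω, G ω ^ 2 ∂μ
      - (2 * K + η / √ε) * ∫ ω, g ω ^ 2 / (ε + w ω + δ ω) ∂μ
      ≤ ∫ ω, G ω * g ω / √(ε + w ω + δ ω) ∂μ := by
    intro η hη
    have hφ2 : StronglyMeasurable[m] fun ω => G ω ^ 2 / (4 * (ρ ω + η) * √(ε + w ω + ρ ω)) :=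
      ((hGm.pow_const 2).div ((measurable_const.mul (hρm'.add measurable_const)).mul
        hVm)).stronglyMeasurable
    have hφ2B : ∀ ω, |G ω ^ 2 / (4 * (ρ ω + η) * √(ε + w ω + ρ ω))| ≤ B ^ 2 / (4 * η * √ε) := by
      intro ω
      have h1 := hVpos ω
      have h2 := hρ0 ω
      rw [abs_of_nonneg (by positivity)]
      refine div_le_div₀ (by positivity) (hGsq ω) (by positivity) ?_
      exact mul_le_mul (by linarith) (hV ω) hse.le (by positivity)
    have i2 : Integrable (fun ω => G ω ^ 2 / (4 * (ρ ω + η) * √(ε + w ω + ρ ω)) * δ ω) μ :=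
      hδint.bdd_mul (hφ2.mono hm).aestronglyMeasurable (Filter.Eventually.of_forall hφ2B)
    have e2 : ∫ ω, G ω ^ 2 / (4 * (ρ ω + η) * √(ε + w ω + ρ ω)) * δ ω ∂μ
        ≤ 1 / 4 * ∫ ω, G ω ^ 2 / √(ε + w ω + ρ ω) ∂μ := by
      rw [integral_mul_condExp_of_bounded hm hφ2 hφ2B hδint, ← integral_const_mul]
      refine integral_mono_ae ?_ (iGV.const_mul _) ?_
      · exact integrable_condExp.bdd_mul (hφ2.mono hm).aestronglyMeasurable
          (Filter.Eventually.of_forall hφ2B)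
      · filter_upwards [hρae] with ω h
        rw [h]
        have h1 := hVpos ω
        have h2 := hρ0 ω
        have h3 : ρ ω / (ρ ω + η) ≤ 1 := (div_le_one (by positivity)).2 (by linarith)
        calc G ω ^ 2 / (4 * (ρ ω + η) * √(ε + w ω + ρ ω)) * ρ ω
            = 1 / 4 * (G ω ^ 2 / √(ε + w ω + ρ ω)) * (ρ ω / (ρ ω + η)) := by
              field_simp
          _ ≤ 1 / 4 * (G ω ^ 2 / √(ε + w ω + ρ ω)) := mul_le_of_le_one_right (by positivity) h3
    have j1 : Integrable (fun ω => G ω / √(ε + w ω + ρ ω) * g ω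
        - 1 / 4 * (G ω ^ 2 / √(ε + w ω + ρ ω))) μ := i1.sub (iGV.const_mul (1 / 4))
    have j2 : Integrable (fun ω => G ω / √(ε + w ω + ρ ω) * g ω
        - 1 / 4 * (G ω ^ 2 / √(ε + w ω + ρ ω))
        - G ω ^ 2 / (4 * (ρ ω + η) * √(ε + w ω + ρ ω)) * δ ω) μ := j1.sub i2
    have hle := integral_mono_ae (j2.sub (iU.const_mul (2 * K + η / √ε))) iGg (by
        filter_upwards [hρK] with ω h
        exact mul_div_sqrt_sub_le hε (hc ω) (hρ0 ω) (hδ0 ω) hK h hη)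
    simp only [Pi.sub_apply] at hle
    rw [integral_sub j2 (iU.const_mul (2 * K + η / √ε)), integral_sub j1 i2, integral_sub i1 (iGV.const_mul (1 / 4)),
      integral_const_mul, integral_const_mul, e1] at hle
    have : 1 / (2 * M) * ∫ ω, G ω ^ 2 ∂μ = 1 / 2 * (1 / M * ∫ ω, G ω ^ 2 ∂μ) := by ring
    linarith
  refine le_of_forall_pos_le_add fun t ht => ?_
  set U := ∫ ω, g ω ^ 2 / (ε + w ω + δ ω) ∂μ
  have h := key (t * √ε / (U + 1)) (by positivity)
  have h1 : t * √ε / (U + 1) / √ε * U ≤ t := by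
    have : t * √ε / (U + 1) / √ε * U = t * (U / (U + 1)) := by field_simp
    rw [this]
    exact mul_le_of_le_one_right ht.le ((div_le_one (by positivity)).2 (by linarith))
  linarith

end Conditional

/-! ### Independence, the past of the samples, and measurability -/

section Independence

variable {Ω S T : Type*} {m m0 : MeasurableSpace Ω} {mS : MeasurableSpace S}
  {mT : MeasurableSpace T} {P : Measure Ω} [IsProbabilityMeasure P] {ξ : Ω → S} {X : Ω → T}

theorem map_prodMk_of_indep (hm : m ≤ m0) (hξ : Measurable ξ) (hind : Indep m (mS.comap ξ) P)
    (hX : Measurable[m] X) :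
    P.map (fun ω => (X ω, ξ ω)) = (P.map X).prod (P.map ξ) := by
  have h : IndepFun X ξ P := (IndepFun_iff_Indep X ξ P).2 (indep_of_indep_of_le_left hind hX.comap_le)
  exact (indepFun_iff_map_prod_eq_prod_map_map (hX.mono hm le_rfl).aemeasurable hξ.aemeasurable).1 h

theorem ae_prod_of_indep (hm : m ≤ m0) (hξ : Measurable ξ) (hind : Indep m (mS.comap ξ) P)
    (hX : Measurable[m] X) {p : T × S → Prop} (hp : MeasurableSet {z | p z})
    (h : ∀ x, ∀ᵐ s ∂P.map ξ, p (x, s)) : ∀ᵐ ω ∂P, p (X ω, ξ ω) := by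
  have hXm : Measurable X := hX.mono hm le_rfl
  have := Measure.isProbabilityMeasure_map (μ := P) hξ.aemeasurable
  have h1 : ∀ᵐ z ∂(P.map X).prod (P.map ξ), p z :=
    (Measure.ae_prod_iff_ae_ae hp).2 (Filter.Eventually.of_forall h)
  rw [← map_prodMk_of_indep hm hξ hind hX] at h1
  exact ae_of_ae_map (hXm.prodMk hξ).aemeasurable h1

/-- Freezing: if `X` is known given `m` and `ξ` is independent of `m`, then the conditional
expectation of `ψ (X, ξ)` given `m` integrates out `ξ` only. -/
theorem condExp_of_indep (hm : m ≤ m0) (hξ : Measurable ξ) (hind : Indep m (mS.comap ξ) P)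
    (hX : Measurable[m] X) {ψ : T × S → ℝ} (hψ : Measurable ψ) {B : ℝ}
    (hB : ∀ x, ∀ᵐ s ∂P.map ξ, |ψ (x, s)| ≤ B) :
    P[fun ω => ψ (X ω, ξ ω)|m] =ᵐ[P] fun ω => ∫ s, ψ (X ω, s) ∂P.map ξ := by
  have hXm : Measurable X := hX.mono hm le_rfl
  have hprob := Measure.isProbabilityMeasure_map (μ := P) hξ.aemeasurable
  have hae : ∀ᵐ ω ∂P, |ψ (X ω, ξ ω)| ≤ B :=
    ae_prod_of_indep hm hξ hind hX (measurableSet_le hψ.abs measurable_const) hB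
  have hΨ : StronglyMeasurable fun x => ∫ s, ψ (x, s) ∂P.map ξ :=
    hψ.stronglyMeasurable.integral_prod_right'
  have hΨB : ∀ x, |∫ s, ψ (x, s) ∂P.map ξ| ≤ B := fun x => by
    have := norm_integral_le_of_norm_le_const (f := fun s => ψ (x, s)) (hB x)
    simpa using this
  have hmeas : StronglyMeasurable[m] fun ω => ∫ s, ψ (X ω, s) ∂P.map ξ :=
    (hΨ.measurable.comp hX).stronglyMeasurable
  have hint : Integrable (fun ω => ψ (X ω, ξ ω)) P :=
    Integrable.of_bound (hψ.comp (hXm.prodMk hξ)).aestronglyMeasurable B hae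
  have hint' : Integrable (fun ω => ∫ s, ψ (X ω, s) ∂P.map ξ) P :=
    Integrable.of_bound (hmeas.mono hm).aestronglyMeasurable B
      (Filter.Eventually.of_forall fun ω => hΨB _)
  refine (ae_eq_condExp_of_forall_setIntegral_eq hm hint (fun s _ _ => hint'.integrableOn)
    (fun s hs _ => ?_) hmeas.aestronglyMeasurable).symm
  -- the event `s` enters through its indicator, as an extra coordinate of `X`
  set Z : Ω → ℝ × T := fun ω => (s.indicator (fun _ => (1 : ℝ)) ω, X ω)
  have hZ : Measurable[m] Z := (measurable_const.indicator hs).prodMk hX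
  have hZm : Measurable Z := hZ.mono hm le_rfl
  have hlaw := map_prodMk_of_indep hm hξ hind hZ
  have hφ : Measurable fun z : (ℝ × T) × S => z.1.1 * ψ (z.1.2, z.2) :=
    (measurable_fst.comp measurable_fst).mul
      (hψ.comp ((measurable_snd.comp measurable_fst).prodMk measurable_snd))
  have hs0 : MeasurableSet s := hm s hs
  have e1 : ∀ h : Ω → ℝ, ∫ ω in s, h ω ∂P = ∫ ω, (Z ω).1 * h ω ∂P := fun h => by
    rw [← integral_indicator hs0]
    refine integral_congr_ae (Filter.Eventually.of_forall fun ω => ?_)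
    by_cases hω : ω ∈ s <;> simp [Z, hω]
  have hi : Integrable (fun ω => (Z ω).1 * ψ (X ω, ξ ω)) P := by
    refine hint.bdd_mul (c := 1) (measurable_fst.comp hZm).aestronglyMeasurable
      (Filter.Eventually.of_forall fun ω => ?_)
    by_cases hω : ω ∈ s <;> simp [Z, hω]
  have hi' : Integrable (fun z : (ℝ × T) × S => z.1.1 * ψ (z.1.2, z.2))
      ((P.map Z).prod (P.map ξ)) := by
    rw [← hlaw]
    exact (integrable_map_measure hφ.aestronglyMeasurable (hZm.prodMk hξ).aemeasurable).2 hi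
  rw [e1, e1]
  calc ∫ ω, (Z ω).1 * ∫ s, ψ (X ω, s) ∂P.map ξ ∂P
      = ∫ z, z.1 * ∫ s, ψ (z.2, s) ∂P.map ξ ∂P.map Z := by
        rw [integral_map hZm.aemeasurable]
        exact (measurable_fst.mul (hΨ.measurable.comp measurable_snd)).aestronglyMeasurable
    _ = ∫ z, ∫ s, z.1 * ψ (z.2, s) ∂P.map ξ ∂P.map Z := by simp only [integral_const_mul]
    _ = ∫ z, z.1.1 * ψ (z.1.2, z.2) ∂(P.map Z).prod (P.map ξ) := (integral_prod _ hi').symm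
    _ = ∫ ω, (Z ω).1 * ψ (X ω, ξ ω) ∂P := by
        rw [← hlaw, integral_map (hZm.prodMk hξ).aemeasurable hφ.aestronglyMeasurable]

end Independence

section Filtration

variable {Ω S : Type*} {m0 : MeasurableSpace Ω} [mS : MeasurableSpace S]

/-- The information carried by the first `n` samples `ξ 0, …, ξ (n - 1)`. -/
abbrev pastSigma (ξ : ℕ → Ω → S) (n : ℕ) : MeasurableSpace Ω :=
  ⨆ j ∈ Set.Iio n, mS.comap (ξ j)

variable {ξ : ℕ → Ω → S}

theorem pastSigma_le (hξ : ∀ n, Measurable (ξ n)) (n : ℕ) : pastSigma ξ n ≤ m0 :=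
  iSup₂_le fun j _ => (hξ j).comap_le

theorem pastSigma_mono {j n : ℕ} (h : j ≤ n) : pastSigma ξ j ≤ pastSigma ξ n :=
  biSup_mono fun _ hi => lt_of_lt_of_le hi h

theorem measurable_sample_pastSigma (n : ℕ) : Measurable[pastSigma ξ (n + 1)] (ξ n) :=
  measurable_iff_comap_le.2 (le_biSup (fun j => mS.comap (ξ j)) (Set.mem_Iio.2 n.lt_succ_self))

theorem pastSigma_le_comap (n : ℕ) :
    pastSigma ξ n ≤ MeasurableSpace.comap (fun ω n => ξ n ω) MeasurableSpace.pi :=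
  iSup₂_le fun j _ => by
    have h : ξ j = (fun y : ℕ → S => y j) ∘ fun ω n => ξ n ω := rfl
    rw [h, ← MeasurableSpace.comap_comp]
    exact MeasurableSpace.comap_mono (measurable_pi_apply j).comap_le

theorem indep_pastSigma {P : Measure Ω} (hξ : ∀ n, Measurable (ξ n)) (hind : iIndepFun ξ P) (n : ℕ) :
    Indep (pastSigma ξ n) (mS.comap (ξ n)) P := by
  have h := indep_iSup_of_disjoint (fun n => (hξ n).comap_le) hind.iIndep
    (S := Set.Iio n) (T := {n}) (by simp)
  simpa [pastSigma] using h

end Filtration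

section Measurability

variable {Ω : Type*} {mΩ : MeasurableSpace Ω} {d : ℕ} {m v x g : Ω → EuclideanSpace ℝ (Fin d)}

theorem measurable_euclidean_apply (hx : Measurable x) (i : Fin d) : Measurable fun ω => x ω i :=
  (measurable_pi_apply i).comp ((WithLp.measurable_ofLp 2 _).comp hx)

theorem measurable_adamNextM (β : ℝ) (hm : Measurable m) (hg : Measurable g) :
    Measurable fun ω => adamNextM β (m ω) (g ω) :=
  (WithLp.measurable_toLp 2 _).comp (measurable_pi_iff.2 fun i =>
    ((measurable_euclidean_apply hm i).const_mul β).add (measurable_euclidean_apply hg i))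

theorem measurable_adamNextV (β : ℝ) (hv : Measurable v) (hg : Measurable g) :
    Measurable fun ω => adamNextV β (v ω) (g ω) :=
  (WithLp.measurable_toLp 2 _).comp (measurable_pi_iff.2 fun i =>
    ((measurable_euclidean_apply hv i).const_mul β).add
      ((measurable_euclidean_apply hg i).pow_const 2))

theorem measurable_adamNextX (ε a : ℝ) (hx : Measurable x) (hm : Measurable m)
    (hv : Measurable v) : Measurable fun ω => adamNextX ε a (x ω) (m ω) (v ω) :=
  (WithLp.measurable_toLp 2 _).comp (measurable_pi_iff.2 fun i =>
    (measurable_euclidean_apply hx i).sub (((measurable_euclidean_apply hm i).div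
      ((measurable_euclidean_apply hv i).const_add ε).sqrt).const_mul a))

end Measurability

section State

variable {Ω S : Type*} [mS : MeasurableSpace S] {d : ℕ}
  {f : S → EuclideanSpace ℝ (Fin d) → ℝ} {ξ : ℕ → Ω → S}

theorem measurable_adamState
    (hf : Measurable fun p : S × EuclideanSpace ℝ (Fin d) => gradient (f p.1) p.2)
    (α β₁ β₂ ε : ℝ) (x₀ : EuclideanSpace ℝ (Fin d)) (n : ℕ) :
    (Measurable[pastSigma ξ n] fun ω => (adamState α β₁ β₂ ε (fun n => f (ξ n ω)) x₀ n).m) ∧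
    (Measurable[pastSigma ξ n] fun ω => (adamState α β₁ β₂ ε (fun n => f (ξ n ω)) x₀ n).v) ∧
    (Measurable[pastSigma ξ n] fun ω => (adamState α β₁ β₂ ε (fun n => f (ξ n ω)) x₀ n).x) := by
  induction n with
  | zero => exact ⟨measurable_const, measurable_const, measurable_const⟩
  | succ n ih =>
    have hle := pastSigma_mono (ξ := ξ) n.le_succ
    have hm := ih.1.mono hle le_rfl
    have hv := ih.2.1.mono hle le_rfl
    have hx := ih.2.2.mono hle le_rfl
    have hg : Measurable[pastSigma ξ (n + 1)] fun ω =>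
        gradient (f (ξ n ω)) (adamState α β₁ β₂ ε (fun n => f (ξ n ω)) x₀ n).x :=
      hf.comp ((measurable_sample_pastSigma n).prodMk hx)
    exact ⟨measurable_adamNextM β₁ hm hg, measurable_adamNextV β₂ hv hg,
      measurable_adamNextX ε _ hx (measurable_adamNextM β₁ hm hg)
        (measurable_adamNextV β₂ hv hg)⟩

end State

/-! ### The constant and the step size -/

theorem Real.rpow_three_halves {y : ℝ} (hy : 0 ≤ y) : y ^ (3 / 2 : ℝ) = y * √y := by
  rcases hy.eq_or_lt with rfl | hy
  · simp
  · rw [show (3 / 2 : ℝ) = 1 + 1 / 2 by norm_num, Real.rpow_add hy, Real.rpow_one,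
      Real.sqrt_eq_rpow]

section Constants

variable {d : ℕ} {α β₁ β₂ R L : ℝ}

theorem adamConst_eq (hβ₂0 : 0 < β₂) (hβ₁₂ : β₁ < β₂) (hβ₂ : β₂ < 1) :
    adamConst d α β₁ β₂ R L = α * d * R * L * (1 - β₁) / ((1 - β₁ / β₂) * (1 - β₂))
      + 12 * d * R ^ 2 * √(1 - β₁) / ((1 - β₁ / β₂) * √(1 - β₁ / β₂) * √(1 - β₂))
      + 2 * α ^ 2 * d * L ^ 2 * β₁ / ((1 - β₁ / β₂) * ((1 - β₂) * √(1 - β₂))) := by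
  have hq : β₁ / β₂ < 1 := (div_lt_one hβ₂0).2 hβ₁₂
  rw [adamConst, Real.rpow_three_halves (by linarith), Real.rpow_three_halves (by linarith)]

theorem adamConst_nonneg (hL : 0 ≤ L) (hR : 0 ≤ R) (hα : 0 ≤ α) (hβ₁ : 0 ≤ β₁) (hβ₁₂ : β₁ < β₂)
    (hβ₂ : β₂ < 1) : 0 ≤ adamConst d α β₁ β₂ R L := by
  have hβ₂0 := hβ₁.trans_lt hβ₁₂
  have hq : 0 < 1 - β₁ / β₂ := sub_pos.2 ((div_lt_one hβ₂0).2 hβ₁₂)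
  have h1 : 0 < 1 - β₁ := by linarith
  have h2 : 0 < 1 - β₂ := by linarith
  rw [adamConst_eq hβ₂0 hβ₁₂ hβ₂]
  positivity

/-- The three error terms of the trajectory estimate add up to at most `α / (2 R)` times the
constant of the bound. -/
theorem error_coefficients_le (hR : 0 < R) (hα : 0 < α) (hβ₁ : 0 ≤ β₁)
    (hβ₁₂ : β₁ < β₂) (hβ₂ : β₂ < 1) {A : ℝ} (hA : A = α * (1 - β₁) / √(1 - β₂)) :
    (L * A ^ 2 / 2 + A ^ 3 * L ^ 2 * β₁ / (R * (1 - β₁) ^ 2))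
        * (1 / ((1 - β₁) * (1 - β₁ / β₂)) * d)
      + (A * R / √(1 - β₁) + 2 * A * R) * (1 / ((1 - β₁ / β₂) * √(1 - β₁ / β₂)) * d)
      ≤ α / (2 * R) * adamConst d α β₁ β₂ R L := by
  have hβ₂0 := hβ₁.trans_lt hβ₁₂
  have hq : 0 < 1 - β₁ / β₂ := sub_pos.2 ((div_lt_one hβ₂0).2 hβ₁₂)
  have h1 : 0 < 1 - β₁ := by linarith
  have h2 : 0 < 1 - β₂ := by linarith
  rw [adamConst_eq hβ₂0 hβ₁₂ hβ₂]
  set y := 1 - β₁ / β₂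
  set r := √y
  have hr : 0 < r := Real.sqrt_pos.2 hq
  have hs : 0 < √(1 - β₁) := Real.sqrt_pos.2 h1
  have hs2 : 1 - β₁ = √(1 - β₁) ^ 2 := (Real.sq_sqrt h1.le).symm
  have hs1 : √(1 - β₁) ≤ 1 := Real.sqrt_le_one.2 (by linarith)
  have ht : 0 < √(1 - β₂) := Real.sqrt_pos.2 h2
  have ht2 : 1 - β₂ = √(1 - β₂) ^ 2 := (Real.sq_sqrt h2.le).symm
  have hA0 : 0 ≤ A := by rw [hA]; positivity
  have e1 : A * R / √(1 - β₁) + 2 * A * R ≤ 3 * (A * R / √(1 - β₁)) := by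
    have : A * R ≤ A * R / √(1 - β₁) := le_div_self (by positivity) hs hs1
    linarith
  calc _ ≤ (L * A ^ 2 / 2 + A ^ 3 * L ^ 2 * β₁ / (R * (1 - β₁) ^ 2))
        * (1 / ((1 - β₁) * y) * d) + 6 * (A * R / √(1 - β₁)) * (1 / (y * r) * d) := by
        gcongr
        refine e1.trans ?_
        have : 0 ≤ A * R / √(1 - β₁) := by positivity
        linarith
    _ = _ := by
        rw [hA]
        generalize √(1 - β₁) = s at *
        generalize √(1 - β₂) = t at *
        rw [hs2, ht2]
        field_simp
        ring

theorem adamConst_le_order (hL : 0 ≤ L) (hR : 0 ≤ R) (hα : 0 ≤ α) (hβ₁ : 0 ≤ β₁)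
    (hβ₁₂ : β₁ < β₂) (hβ₂ : β₂ < 1) :
    adamConst d α β₁ β₂ R L
      ≤ ((1 - β₁) / (1 - β₁ / β₂)) ^ (3 / 2 : ℝ)
        * (α * d * R * L / (1 - β₂) + 12 * d * R ^ 2 / √(1 - β₂)
            + 2 * α ^ 2 * d * L ^ 2 / (1 - β₂) ^ (3 / 2 : ℝ)) / (1 - β₁) := by
  have hβ₂0 := hβ₁.trans_lt hβ₁₂
  have hq : 0 < 1 - β₁ / β₂ := sub_pos.2 ((div_lt_one hβ₂0).2 hβ₁₂)
  have h1 : 0 < 1 - β₁ := by linarith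
  have h2 : 0 < 1 - β₂ := by linarith
  have hqb : 1 - β₁ / β₂ ≤ 1 - β₁ := by
    have : β₁ ≤ β₁ / β₂ := le_div_self hβ₁ hβ₂0 hβ₂.le
    linarith
  have hρ : 1 ≤ (1 - β₁) / (1 - β₁ / β₂) := (one_le_div hq).2 hqb
  rw [adamConst_eq hβ₂0 hβ₁₂ hβ₂, Real.rpow_three_halves (by positivity),
    Real.rpow_three_halves h2.le]
  set ρ := (1 - β₁) / (1 - β₁ / β₂) with hρ_def
  have hρs : 1 ≤ √ρ := Real.one_le_sqrt.2 hρ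
  have hρρ : ρ ≤ ρ * √ρ := le_mul_of_one_le_right (by positivity) hρs
  have hρb : ρ * √ρ ≤ ρ * √ρ / (1 - β₁) := le_div_self (by positivity) h1 (by linarith)
  have t1 : α * d * R * L * (1 - β₁) / ((1 - β₁ / β₂) * (1 - β₂))
      ≤ ρ * √ρ / (1 - β₁) * (α * d * R * L / (1 - β₂)) := by
    calc _ = ρ * (α * d * R * L / (1 - β₂)) := by rw [hρ_def]; field_simp
      _ ≤ _ := by gcongr; exact hρρ.trans hρb
  have t2 : 12 * d * R ^ 2 * √(1 - β₁) / ((1 - β₁ / β₂) * √(1 - β₁ / β₂) * √(1 - β₂))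
      = ρ * √ρ / (1 - β₁) * (12 * d * R ^ 2 / √(1 - β₂)) := by
    rw [hρ_def, Real.sqrt_div h1.le]
    field_simp
  have t3 : 2 * α ^ 2 * d * L ^ 2 * β₁ / ((1 - β₁ / β₂) * ((1 - β₂) * √(1 - β₂)))
      ≤ ρ * √ρ / (1 - β₁) * (2 * α ^ 2 * d * L ^ 2 / ((1 - β₂) * √(1 - β₂))) := by
    calc _ = ρ * β₁ / (1 - β₁) * (2 * α ^ 2 * d * L ^ 2 / ((1 - β₂) * √(1 - β₂))) := by
          rw [hρ_def]; field_simp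
      _ ≤ _ := by
          gcongr
          linarith
  calc _ ≤ ρ * √ρ / (1 - β₁) * (α * d * R * L / (1 - β₂))
        + ρ * √ρ / (1 - β₁) * (12 * d * R ^ 2 / √(1 - β₂))
        + ρ * √ρ / (1 - β₁) * (2 * α ^ 2 * d * L ^ 2 / ((1 - β₂) * √(1 - β₂))) := by
        rw [t2]
        gcongr
    _ = _ := by ring

end Constants

theorem log_factor_nonneg {β₂ ε R : ℝ} (hε : 0 ≤ ε) (hβ₂ : 0 ≤ β₂) (hβ₂1 : β₂ < 1) (N : ℕ) :
    0 ≤ Real.log (1 + R ^ 2 / ((1 - β₂) * ε)) - N * Real.log β₂ := by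
  have h1 : 0 < 1 - β₂ := sub_pos.2 hβ₂1
  have h2 : 0 ≤ R ^ 2 / ((1 - β₂) * ε) := by positivity
  exact sub_nonneg.2 ((mul_nonpos_of_nonneg_of_nonpos N.cast_nonneg
    (Real.log_nonpos hβ₂ hβ₂1.le)).trans (Real.log_nonneg (by linarith)))

theorem adamStepSize_nonneg {α β₁ β₂ : ℝ} (hα : 0 ≤ α) (hβ₁ : β₁ ≤ 1) (n : ℕ) :
    0 ≤ adamStepSize α β₁ β₂ n :=
  mul_nonneg (mul_nonneg hα (sub_nonneg.2 hβ₁)) (Real.sqrt_nonneg _)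

theorem adamStepSize_le {α β₁ β₂ : ℝ} (hα : 0 ≤ α) (hβ₁ : β₁ ≤ 1) (hβ₂ : 0 ≤ β₂) (hβ₂1 : β₂ < 1)
    (n : ℕ) : adamStepSize α β₁ β₂ n ≤ α * (1 - β₁) / √(1 - β₂) := by
  have h1 : 0 < 1 - β₂ := sub_pos.2 hβ₂1
  rw [adamStepSize, div_eq_mul_one_div (α * (1 - β₁)),
    show 1 / √(1 - β₂) = √(1 / (1 - β₂)) by rw [Real.sqrt_div zero_le_one, Real.sqrt_one]]
  have := mul_nonneg hα (sub_nonneg.2 hβ₁)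
  gcongr
  have := pow_nonneg hβ₂ n
  linarith

/-! ### The weighted sum of expected squared gradients -/

open Finset in
theorem sum_range_geom_delay {β : ℝ} (hβ : β ≠ 1) (D : ℕ → ℝ) (N : ℕ) :
    ∑ n ∈ range N, ∑ j ∈ range (n + 1), β ^ (n - j) * D j
      = 1 / (1 - β) * ∑ j ∈ range N, (1 - β ^ (N - j)) * D j := by
  rw [sum_range_diag_flip N fun j k => β ^ k * D j, mul_sum]
  refine sum_congr rfl fun j _ => ?_
  rw [← sum_mul, geom_sum_eq hβ]
  have h1 : β - 1 ≠ 0 := sub_ne_zero.2 hβ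
  have h2 : 1 - β ≠ 0 := sub_ne_zero.2 hβ.symm
  field_simp
  ring

open Finset in
theorem integral_sum_mul_sum_mul_sum {Ω ι : Type*} [Fintype ι] {m0 : MeasurableSpace Ω}
    {P : Measure Ω} (a : ℕ → ℝ) (b : ℕ → ℕ → ℝ) {X : ℕ → ℕ → ι → Ω → ℝ}
    (hX : ∀ n j i, Integrable (X n j i) P) (N : ℕ) :
    Integrable (fun ω => ∑ n ∈ range N, a n * ∑ j ∈ range (n + 1), b n j * ∑ i, X n j i ω) P ∧
    ∫ ω, ∑ n ∈ range N, a n * ∑ j ∈ range (n + 1), b n j * ∑ i, X n j i ω ∂P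
      = ∑ n ∈ range N, a n * ∑ j ∈ range (n + 1), b n j * ∑ i, ∫ ω, X n j i ω ∂P := by
  have h1 : ∀ n j, Integrable (fun ω => ∑ i, X n j i ω) P := fun n j =>
    integrable_finsetSum _ fun i _ => hX n j i
  have h2 : ∀ n, Integrable (fun ω => ∑ j ∈ range (n + 1), b n j * ∑ i, X n j i ω) P := fun n =>
    integrable_finsetSum _ fun j _ => (h1 n j).const_mul _
  refine ⟨integrable_finsetSum _ fun n _ => (h2 n).const_mul _, ?_⟩
  rw [integral_finsetSum _ fun n _ => (h2 n).const_mul _]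
  refine sum_congr rfl fun n _ => ?_
  rw [integral_const_mul, integral_finsetSum _ fun j _ => (h1 n j).const_mul _]
  congr 1
  refine sum_congr rfl fun j _ => ?_
  rw [integral_const_mul, integral_finsetSum _ fun i _ => hX n j i]

section Expectation

variable {Ω : Type*} {m0 : MeasurableSpace Ω} {P : Measure Ω} [IsProbabilityMeasure P]
  {d : ℕ} {F : EuclideanSpace ℝ (Fin d) → ℝ} {α β₁ β₂ ε R L Fstar : ℝ}
  {x m v g : ℕ → Ω → EuclideanSpace ℝ (Fin d)} {𝓕 : ℕ → MeasurableSpace Ω}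

/-- The expected squared gradients along the trajectory, weighted by `1 - β₁ ^ (N - j)`. The
stochastic gradients `g` enter only through their almost sure bound and their conditional means
given the past `𝓕`. -/
theorem sum_weighted_integral_norm_sq_gradient_le
    (hF : Differentiable ℝ F) (hL0 : 0 ≤ L)
    (hL : ∀ x y, ‖gradient F x - gradient F y‖ ≤ L * ‖x - y‖) (hFstar : ∀ x, Fstar ≤ F x)
    (hFB : ∀ x i, |gradient F x i| ≤ R - √ε)
    (hε : 0 < ε) (hR : √ε ≤ R) (hα : 0 < α) (hβ₁ : 0 ≤ β₁) (hβ₁₂ : β₁ < β₂) (hβ₂ : β₂ < 1)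
    (h𝓕 : ∀ n, 𝓕 n ≤ m0) (hxm : ∀ n, Measurable[𝓕 n] (x n)) (hvm : ∀ n, Measurable[𝓕 n] (v n))
    (hgm : ∀ n, Measurable (g n))
    (hgB : ∀ᵐ ω ∂P, ∀ n i, |g n ω i| ≤ R - √ε)
    (hgF : ∀ n i, P[fun ω => g n ω i|𝓕 n] =ᵐ[P] fun ω => gradient F (x n ω) i)
    {x₀ : EuclideanSpace ℝ (Fin d)}
    (hx0 : ∀ ω, x 0 ω = x₀) (hm0 : ∀ ω, m 0 ω = 0) (hv0 : ∀ ω, v 0 ω = 0)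
    (hm : ∀ n ω i, m (n + 1) ω i = β₁ * m n ω i + g n ω i)
    (hv : ∀ n ω i, v (n + 1) ω i = β₂ * v n ω i + g n ω i ^ 2)
    (hx : ∀ n ω i, x (n + 1) ω i = x n ω i
      - adamStepSize α β₁ β₂ (n + 1) * (m (n + 1) ω i / √(ε + v (n + 1) ω i))) (N : ℕ) :
    α / (2 * R) * ∑ j ∈ Finset.range N,
        (1 - β₁ ^ (N - j)) * ∫ ω, ‖gradient F (x j ω)‖ ^ 2 ∂P
      ≤ F x₀ - Fstar + α / (2 * R) * (adamConst d α β₁ β₂ R L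
        * (Real.log (1 + R ^ 2 / ((1 - β₂) * ε)) - N * Real.log β₂)) := by
  have hβ₂0 : 0 < β₂ := hβ₁.trans_lt hβ₁₂
  have hβ₁1 : β₁ < 1 := hβ₁₂.trans hβ₂
  have hb : 0 < 1 - β₁ := sub_pos.2 hβ₁1
  have hc : 0 < 1 - β₂ := sub_pos.2 hβ₂
  have hse : 0 < √ε := Real.sqrt_pos.2 hε
  have hR0 : 0 < R := hse.trans_le hR
  have hB0 : 0 ≤ R - √ε := sub_nonneg.2 hR
  have hBR : R - √ε ≤ R := by linarith
  set a : ℕ → ℝ := fun n => adamStepSize α β₁ β₂ (n + 1) with ha_def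
  set A : ℝ := α * (1 - β₁) / √(1 - β₂) with hA_def
  have ha0 : ∀ n, 0 ≤ a n := fun n => adamStepSize_nonneg hα.le hβ₁1.le _
  have haA : ∀ n, a n ≤ A := fun n => adamStepSize_le hα.le hβ₁1.le hβ₂0.le hβ₂ _
  have hA0 : 0 ≤ A := (ha0 0).trans (haA 0)
  set Q : ℝ := Real.log (1 + R ^ 2 / ((1 - β₂) * ε)) - N * Real.log β₂ with hQ
  have hvn : ∀ n ω i, 0 ≤ v n ω i := fun n ω i => decayed_sq_nonneg (v := fun n => v n ω i)
    (g := fun n => g n ω i) hβ₂0.le (by simp [hv0]) (fun n => hv n ω i) n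
  have hpos : ∀ n ω i, ε ≤ ε + v n ω i := fun n ω i => le_add_of_nonneg_right (hvn n ω i)
  have hgi : ∀ n i, Measurable fun ω => g n ω i := fun n i => measurable_euclidean_apply (hgm n) i
  have hvi : ∀ n i, Measurable[𝓕 n] fun ω => v n ω i := fun n i =>
    measurable_euclidean_apply (hvm n) i
  have hvi0 : ∀ n i, Measurable fun ω => v n ω i := fun n i => (hvi n i).mono (h𝓕 n) le_rfl
  have hFcont : Continuous (gradient F) := continuous_gradient_of_lipschitz hL0 hL
  have hGi : ∀ n i, Measurable[𝓕 n] fun ω => gradient F (x n ω) i := fun n i =>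
    measurable_euclidean_apply (hFcont.measurable.comp (hxm n)) i
  have hGi0 : ∀ n i, Measurable fun ω => gradient F (x n ω) i := fun n i =>
    (hGi n i).mono (h𝓕 n) le_rfl
  -- integrability of the two families of terms
  set X : ℕ → ℕ → Fin d → Ω → ℝ := fun n j i ω =>
    gradient F (x j ω) i * g j ω i / √(ε + v (n + 1) ω i) with hX
  set V : ℕ → ℕ → Fin d → Ω → ℝ := fun n j i ω => g j ω i ^ 2 / (ε + v (n + 1) ω i) with hV
  have hXi : ∀ n j i, Integrable (X n j i) P := fun n j i =>
    Integrable.of_bound (((hGi0 j i).mul (hgi j i)).div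
      ((hvi0 (n + 1) i).const_add ε).sqrt).aestronglyMeasurable
      ((R - √ε) * (R - √ε) / √ε) (by
      filter_upwards [hgB] with ω h
      have h1 : √ε ≤ √(ε + v (n + 1) ω i) := Real.sqrt_le_sqrt (hpos _ _ _)
      simp only [hX]
      rw [Real.norm_eq_abs, abs_div, abs_mul, abs_of_pos (hse.trans_le h1)]
      exact div_le_div₀ (by positivity) (mul_le_mul (hFB _ _) (h _ _) (abs_nonneg _) hB0) hse h1)
  have hVi : ∀ n j i, Integrable (V n j i) P := fun n j i =>
    Integrable.of_bound (((hgi j i).pow_const 2).div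
      ((hvi0 (n + 1) i).const_add ε)).aestronglyMeasurable ((R - √ε) ^ 2 / ε) (by
      filter_upwards [hgB] with ω h
      have h1 := hε.trans_le (hpos (n + 1) ω i)
      simp only [hV]
      rw [Real.norm_eq_abs, abs_of_nonneg (by positivity)]
      exact div_le_div₀ (by positivity) (sq_le_sq' (abs_le.1 (h j i)).1 (abs_le.1 (h j i)).2) hε
        (hpos _ _ _))
  obtain ⟨hXint, hXeq⟩ := integral_sum_mul_sum_mul_sum a (fun n j => β₁ ^ (n - j)) hXi N
  obtain ⟨hVint, hVeq⟩ := integral_sum_mul_sum_mul_sum (fun _ => 1)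
    (fun n j => β₁ ^ (n - j) * √((n - j : ℕ) + 1)) hVi N
  simp only [one_mul] at hVint hVeq
  set W := ∑ n ∈ Finset.range N, ∑ j ∈ Finset.range (n + 1),
    β₁ ^ (n - j) * √((n - j : ℕ) + 1) * ∑ i, ∫ ω, V n j i ω ∂P with hW
  -- almost sure bounds along the trajectory
  have hU : ∀ᵐ ω ∂P, ∑ n ∈ Finset.range N, ∑ i, g n ω i ^ 2 / (ε + v (n + 1) ω i) ≤ d * Q := by
    filter_upwards [hgB] with ω h
    rw [Finset.sum_comm]
    calc _ ≤ ∑ _i : Fin d, Q := Finset.sum_le_sum fun i _ =>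
          sum_sq_div_add_decayed_sq_le (v := fun n => v n ω i) (g := fun n => g n ω i) hβ₂0 hβ₂ hε
            (by simp [hv0]) (fun n => hv n ω i) (fun n => (h n i).trans hBR) N
      _ = d * Q := by simp
  have hWle : W ≤ 1 / ((1 - β₁ / β₂) * √(1 - β₁ / β₂)) * (d * Q) := by
    have hq : 0 < 1 - β₁ / β₂ := sub_pos.2 ((div_lt_one hβ₂0).2 hβ₁₂)
    rw [← hVeq]
    refine (integral_mono_ae hVint (integrable_const (1 / ((1 - β₁ / β₂) * √(1 - β₁ / β₂))
      * (d * Q))) ?_).trans (by simp)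
    filter_upwards [hU] with ω hω
    refine (sum_delayed_sq_div_le (v := fun n => v n ω) (g := fun n => g n ω) hβ₁ hβ₁₂ hβ₂ hε
      (hv0 ω) (fun n i => hv n ω i) N).trans ?_
    gcongr
  have hpath : ∀ᵐ ω ∂P, ∑ n ∈ Finset.range N, a n * ∑ j ∈ Finset.range (n + 1),
        β₁ ^ (n - j) * ∑ i, X n j i ω
      ≤ (F x₀ - Fstar + (L * A ^ 2 / 2 + A ^ 3 * L ^ 2 * β₁ / (R * (1 - β₁) ^ 2))
          * (1 / ((1 - β₁) * (1 - β₁ / β₂)) * (d * Q)))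
        + A * R / √(1 - β₁) * ∑ n ∈ Finset.range N, ∑ j ∈ Finset.range (n + 1),
          β₁ ^ (n - j) * √((n - j : ℕ) + 1) * ∑ i, V n j i ω := by
    filter_upwards [hU] with ω hω
    have hq : 0 < 1 - β₁ / β₂ := sub_pos.2 ((div_lt_one hβ₂0).2 hβ₁₂)
    have h1 := sum_mul_div_sqrt_le (x := fun n => x n ω) (m := fun n => m n ω)
      (v := fun n => v n ω) (g := fun n => g n ω) hF hL0 hL hFstar hβ₁ hβ₁1 hR0 hε (hm0 ω)
      (fun n i => hm n ω i) (fun n i => hvn n ω i) (fun n i => hx n ω i) ha0 haA N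
    rw [hx0] at h1
    refine h1.trans ?_
    gcongr
    rw [Finset.sum_comm]
    calc _ ≤ ∑ i : Fin d, 1 / ((1 - β₁) * (1 - β₁ / β₂))
          * ∑ n ∈ Finset.range N, g n ω i ^ 2 / (ε + v (n + 1) ω i) :=
          Finset.sum_le_sum fun i _ => sum_sq_momentum_div_le (m := fun n => m n ω i)
            (v := fun n => v n ω i) (g := fun n => g n ω i) hβ₁ hβ₁₂ hβ₂ hε (by simp [hm0])
            (fun n => hm n ω i) (by simp [hv0]) (fun n => hv n ω i) N
      _ ≤ _ := by
          rw [← Finset.mul_sum, Finset.sum_comm]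
          gcongr
  have hEX := integral_mono_ae hXint ((integrable_const _).add (hVint.const_mul _)) hpath
  simp only [Pi.add_apply] at hEX
  rw [integral_add (integrable_const _) (hVint.const_mul _), integral_const_mul, hVeq, hXeq] at hEX
  simp only [integral_const, probReal_univ, one_smul] at hEX
  -- lower bound on the expected correlation of past gradients with their estimates
  have hcorr : ∀ n j i, j ≤ n → α * (1 - β₁) / (2 * R) * ∫ ω, gradient F (x j ω) i ^ 2 ∂P
      - 2 * A * R * √((n - j : ℕ) + 1) * ∫ ω, V n j i ω ∂P ≤ a n * ∫ ω, X n j i ω ∂P := by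
    intro n j i hjn
    have hj1 : j ≤ n + 1 := hjn.trans n.le_succ
    have hS : 0 < (1 - β₂ ^ (n + 1)) / (1 - β₂) :=
      div_pos (sub_pos.2 (pow_lt_one₀ hβ₂0.le hβ₂ n.succ_ne_zero)) hc
    have hM : 0 < R * √((1 - β₂ ^ (n + 1)) / (1 - β₂)) := mul_pos hR0 (Real.sqrt_pos.2 hS)
    have hsplit : ∀ ω, ε + β₂ ^ (n + 1 - j) * v j ω i
        + (v (n + 1) ω i - β₂ ^ (n + 1 - j) * v j ω i) = ε + v (n + 1) ω i := fun ω => by ring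
    have h := le_integral_mul_div_sqrt (μ := P) (h𝓕 j)
      (G := fun ω => gradient F (x j ω) i) (g := fun ω => g j ω i)
      (w := fun ω => β₂ ^ (n + 1 - j) * v j ω i)
      (δ := fun ω => v (n + 1) ω i - β₂ ^ (n + 1 - j) * v j ω i)
      (B := R - √ε) (K := R * √((n - j : ℕ) + 1))
      (M := R * √((1 - β₂ ^ (n + 1)) / (1 - β₂))) hε (by positivity) hM
      (hGi j i).stronglyMeasurable (fun ω => hFB _ _) (hgi j i).aestronglyMeasurable
      (by filter_upwards [hgB] with ω h using h j i) (hgF j i)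
      ((hvi j i).const_mul _).stronglyMeasurable
      (fun ω => mul_nonneg (pow_nonneg hβ₂0.le _) (hvn j ω i))
      ((hvi0 (n + 1) i).sub ((hvi0 j i).const_mul _)).aestronglyMeasurable
      (fun ω => sub_nonneg.2 (pow_mul_decayed_sq_le (v := fun n => v n ω i)
        (g := fun n => g n ω i) hβ₂0.le (fun n => hv n ω i) hj1))
      (by
        filter_upwards [hgB] with ω h
        refine (decayed_sq_sub_le (v := fun n => v n ω i) (g := fun n => g n ω i) hβ₂0.le hβ₂
          (fun n => hv n ω i) (fun n => (h n i).trans hBR) hj1).trans (le_of_eq ?_)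
        rw [mul_pow, Real.sq_sqrt (by positivity), Nat.succ_sub hjn]
        push_cast
        ring)
      (by
        filter_upwards [hgB] with ω h
        rw [hsplit, mul_pow, Real.sq_sqrt hS.le]
        exact add_decayed_sq_le (v := fun n => v n ω i) (g := fun n => g n ω i) hβ₂0.le hβ₂ hε.le
          (by simp [hv0]) (fun n => hv n ω i) (fun n => h n i) n)
    simp only [hsplit] at h
    have h2 := mul_le_mul_of_nonneg_left h (ha0 n)
    refine le_trans ?_ h2
    -- the step size cancels the growth of the denominator
    have h3 : a n * (1 / (2 * (R * √((1 - β₂ ^ (n + 1)) / (1 - β₂))))) = α * (1 - β₁) / (2 * R) := by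
      have := Real.sqrt_pos.2 hS
      simp only [ha_def, adamStepSize]
      field_simp
    have hV0 : 0 ≤ ∫ ω, V n j i ω ∂P := integral_nonneg fun ω => by
      have := hε.trans_le (hpos (n + 1) ω i)
      simp only [hV, Pi.zero_apply]
      positivity
    rw [mul_sub (a n), ← mul_assoc (a n), h3]
    refine sub_le_sub_left ?_ _
    calc a n * (2 * (R * √((n - j : ℕ) + 1)) * ∫ ω, V n j i ω ∂P)
        ≤ A * (2 * (R * √((n - j : ℕ) + 1)) * ∫ ω, V n j i ω ∂P) := by
          gcongr
          exact haA n
      _ = _ := by ring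
  have hD : ∀ j, ∑ i, ∫ ω, gradient F (x j ω) i ^ 2 ∂P = ∫ ω, ‖gradient F (x j ω)‖ ^ 2 ∂P := by
    intro j
    rw [← integral_finsetSum]
    · simp only [EuclideanSpace.real_norm_sq_eq]
    · intro i _
      refine Integrable.of_bound ((hGi0 j i).pow_const 2).aestronglyMeasurable ((R - √ε) ^ 2)
        (Filter.Eventually.of_forall fun ω => ?_)
      rw [Real.norm_eq_abs, abs_of_nonneg (sq_nonneg _)]
      exact sq_le_sq' (abs_le.1 (hFB _ i)).1 (abs_le.1 (hFB _ i)).2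
  have hsum : α * (1 - β₁) / (2 * R) * ∑ n ∈ Finset.range N, ∑ j ∈ Finset.range (n + 1),
        β₁ ^ (n - j) * ∫ ω, ‖gradient F (x j ω)‖ ^ 2 ∂P - 2 * A * R * W
      ≤ ∑ n ∈ Finset.range N, a n * ∑ j ∈ Finset.range (n + 1), β₁ ^ (n - j)
        * ∑ i, ∫ ω, X n j i ω ∂P := by
    rw [hW, Finset.mul_sum, Finset.mul_sum, ← Finset.sum_sub_distrib]
    refine Finset.sum_le_sum fun n _ => ?_
    rw [Finset.mul_sum, Finset.mul_sum, Finset.mul_sum, ← Finset.sum_sub_distrib]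
    refine Finset.sum_le_sum fun j hj => ?_
    rw [← hD]
    calc _ = β₁ ^ (n - j) * ∑ i, (α * (1 - β₁) / (2 * R) * ∫ ω, gradient F (x j ω) i ^ 2 ∂P
          - 2 * A * R * √((n - j : ℕ) + 1) * ∫ ω, V n j i ω ∂P) := by
          rw [Finset.sum_sub_distrib, ← Finset.mul_sum, ← Finset.mul_sum]
          ring
      _ ≤ β₁ ^ (n - j) * ∑ i, a n * ∫ ω, X n j i ω ∂P := by
          gcongr with i _
          exact hcorr n j i (Nat.lt_succ_iff.1 (Finset.mem_range.1 hj))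
      _ = _ := by
          rw [← Finset.mul_sum]
          ring
  rw [sum_range_geom_delay hβ₁1.ne] at hsum
  have hQ0 : 0 ≤ Q := log_factor_nonneg hε.le hβ₂0.le hβ₂ N
  have hcoef := mul_le_mul_of_nonneg_right (error_coefficients_le (d := d) (L := L) hR0 hα hβ₁ hβ₁₂ hβ₂
    hA_def) hQ0
  have hWle' := mul_le_mul_of_nonneg_left hWle
    (show 0 ≤ A * R / √(1 - β₁) + 2 * A * R by positivity)
  have hfac : ∀ t : ℝ, α * (1 - β₁) / (2 * R) * (1 / (1 - β₁) * t) = α / (2 * R) * t := fun t => by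
    field_simp
  rw [hfac] at hsum
  linarith

end Expectation

/-! ### The random index and the convergence bound -/

section Gradients

variable {S : Type*} [MeasurableSpace S] {ν : Measure S} [IsProbabilityMeasure ν] {d : ℕ}
  {f : S → EuclideanSpace ℝ (Fin d) → ℝ} {F : EuclideanSpace ℝ (Fin d) → ℝ} {B : ℝ}

theorem integrable_gradient_of_bounded
    (hf : Measurable fun p : S × EuclideanSpace ℝ (Fin d) => gradient (f p.1) p.2)
    {x : EuclideanSpace ℝ (Fin d)} (hB : ∀ᵐ s ∂ν, ∀ i, |gradient (f s) x i| ≤ B) :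
    Integrable (fun s => gradient (f s) x) ν := by
  refine Integrable.of_bound (hf.comp (measurable_id.prodMk measurable_const)).aestronglyMeasurable
    (√(∑ _i : Fin d, B ^ 2)) ?_
  filter_upwards [hB] with s hs
  rw [EuclideanSpace.norm_eq]
  refine Real.sqrt_le_sqrt (Finset.sum_le_sum fun i _ => ?_)
  rw [Real.norm_eq_abs, sq_abs]
  exact sq_le_sq' (abs_le.1 (hs i)).1 (abs_le.1 (hs i)).2

theorem integral_gradient_apply
    (hf : Measurable fun p : S × EuclideanSpace ℝ (Fin d) => gradient (f p.1) p.2)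
    {x : EuclideanSpace ℝ (Fin d)} (hB : ∀ᵐ s ∂ν, ∀ i, |gradient (f s) x i| ≤ B)
    (hmean : ∫ s, gradient (f s) x ∂ν = gradient F x) (i : Fin d) :
    ∫ s, gradient (f s) x i ∂ν = gradient F x i := by
  rw [← hmean]
  exact (EuclideanSpace.proj (𝕜 := ℝ) i).integral_comp_comm (integrable_gradient_of_bounded hf hB)

end Gradients

/-- A random index independent of a family of bounded random variables averages their
expectations with its own weights. -/
theorem integral_comp_of_indep {Ω : Type*} {m m0 : MeasurableSpace Ω} {P : Measure Ω}
    [IsProbabilityMeasure P] {N : ℕ} {τ : Ω → Fin N} (hτ : Measurable τ)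
    (hm : m ≤ m0) (hind : Indep (MeasurableSpace.comap τ inferInstance) m P)
    {D : ℕ → Ω → ℝ} (hD : ∀ j, Measurable[m] (D j)) {C : ℝ} (hC : ∀ j ω, |D j ω| ≤ C) :
    Integrable (fun ω => D (τ ω) ω) P ∧
      ∫ ω, D (τ ω) ω ∂P = ∑ j : Fin N, P.real (τ ⁻¹' {j}) * ∫ ω, D j ω ∂P := by
  have hD0 : ∀ j, Measurable (D j) := fun j => (hD j).mono hm le_rfl
  have hDi : ∀ j, Integrable (D j) P := fun j =>
    Integrable.of_bound (hD0 j).aestronglyMeasurable C (Filter.Eventually.of_forall (hC j))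
  have hset : ∀ j, MeasurableSet (τ ⁻¹' {j}) := fun j => hτ (measurableSet_singleton j)
  have hsum : (fun ω => D (τ ω) ω)
      = fun ω => ∑ j : Fin N, (τ ⁻¹' {j}).indicator (fun _ => (1 : ℝ)) ω * D j ω := by
    funext ω
    rw [Finset.sum_eq_single (τ ω)]
    · simp
    · intro j _ hj
      simp [Set.indicator_of_notMem (show ω ∉ τ ⁻¹' {j} from fun h => hj h.symm)]
    · simp
  have hterm : ∀ j : Fin N, Integrable
      (fun ω => (τ ⁻¹' {j}).indicator (fun _ => (1 : ℝ)) ω * D j ω) P := fun j => by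
    refine (hDi j).bdd_mul (c := 1) (measurable_const.indicator (hset j)).aestronglyMeasurable
      (Filter.Eventually.of_forall fun ω => ?_)
    by_cases hω : ω ∈ τ ⁻¹' {j} <;> simp [hω]
  rw [hsum]
  refine ⟨integrable_finsetSum _ fun j _ => hterm j, ?_⟩
  rw [integral_finsetSum _ fun j _ => hterm j]
  refine Finset.sum_congr rfl fun j _ => ?_
  have hI : IndepFun ((τ ⁻¹' {j}).indicator fun _ => (1 : ℝ)) (D j) P := by
    rw [IndepFun_iff_Indep]
    refine indep_of_indep_of_le_left (indep_of_indep_of_le_right hind (hD j).comap_le) ?_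
    have : Measurable[MeasurableSpace.comap τ inferInstance]
        ((τ ⁻¹' {j}).indicator fun _ => (1 : ℝ)) :=
      measurable_const.indicator ⟨{j}, measurableSet_singleton j, rfl⟩
    exact this.comap_le
  rw [hI.integral_fun_mul_eq_mul_integral (measurable_const.indicator (hset j)).aestronglyMeasurable
    (hD0 j).aestronglyMeasurable, integral_indicator_const _ (hset j), smul_eq_mul, mul_one]

/-- The weights `1 - β ^ (N - j)` have total mass at least `N - β / (1 - β)`. -/
theorem sub_div_le_sum_one_sub_pow {β : ℝ} (hβ : 0 ≤ β) (hβ1 : β < 1) (N : ℕ) :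
    N - β / (1 - β) ≤ ∑ j ∈ Finset.range N, (1 - β ^ (N - j)) := by
  have h1 : 0 < 1 - β := sub_pos.2 hβ1
  rw [← Finset.sum_range_reflect]
  have h2 : ∀ j ∈ Finset.range N, 1 - β ^ (N - (N - 1 - j)) = 1 - β * β ^ j := fun j hj => by
    have := Finset.mem_range.1 hj
    rw [show N - (N - 1 - j) = j + 1 by omega, pow_succ']
  rw [Finset.sum_congr rfl h2, Finset.sum_sub_distrib, ← Finset.mul_sum]
  have h3 := mul_le_mul_of_nonneg_left (sum_range_pow_le hβ hβ1 N) hβ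
  rw [mul_one_div] at h3
  simp
  linarith

/-- The convergence bound when the smoothness constant is nonnegative, which the hypotheses force
in positive dimension. -/
theorem adam_bound_of_nonneg
    (d : ℕ) (F : EuclideanSpace ℝ (Fin d) → ℝ) (hF : Differentiable ℝ F)
    {S : Type*} [MeasurableSpace S] (ν : Measure S) [IsProbabilityMeasure ν]
    (f : S → EuclideanSpace ℝ (Fin d) → ℝ)
    (hf_meas : Measurable fun p : S × EuclideanSpace ℝ (Fin d) => gradient (f p.1) p.2)
    (hf_mean : ∀ x, ∫ s, gradient (f s) x ∂ν = gradient F x)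
    {Ω : Type*} [MeasurableSpace Ω] (P : Measure Ω) [IsProbabilityMeasure P]
    (ξ : ℕ → Ω → S) (hξ_meas : ∀ n, Measurable (ξ n))
    (hξ_indep : iIndepFun ξ P) (hξ_law : ∀ n, P.map (ξ n) = ν)
    (Fstar : ℝ) (hF_below : ∀ x, Fstar ≤ F x)
    (ε : ℝ) (hε : 0 < ε) (R : ℝ) (hR : √ε ≤ R)
    (hf_bound : ∀ x : EuclideanSpace ℝ (Fin d), ∀ᵐ s ∂ν,
      ‖WithLp.ofLp (gradient (f s) x)‖ ≤ R - √ε)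
    (L : ℝ) (hL0 : 0 ≤ L) (hF_smooth : ∀ x y, ‖gradient F x - gradient F y‖ ≤ L * ‖x - y‖)
    (α β₁ β₂ : ℝ) (hα : 0 < α) (hβ₁ : 0 ≤ β₁) (hβ₁₂ : β₁ < β₂) (hβ₂ : β₂ < 1)
    (x₀ : EuclideanSpace ℝ (Fin d))
    (N : ℕ) (hN : β₁ / (1 - β₁) < N)
    (τ : Ω → Fin N) (hτ_meas : Measurable τ) (hτ_indep : IndepFun τ (fun ω n => ξ n ω) P)
    (hτ_law : ∃ c : ℝ, ∀ j : Fin N, P.real (τ ⁻¹' {j}) = c * (1 - β₁ ^ (N - (j : ℕ)))) :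
    Integrable (fun ω =>
        ‖gradient F (adamState α β₁ β₂ ε (fun n => f (ξ n ω)) x₀ (τ ω)).x‖ ^ 2) P ∧
      ∫ ω, ‖gradient F (adamState α β₁ β₂ ε (fun n => f (ξ n ω)) x₀ (τ ω)).x‖ ^ 2 ∂P
        ≤ 2 * R * ((F x₀ - Fstar) / (α * (N - β₁ / (1 - β₁))))
          + adamConst d α β₁ β₂ R L
            * (1 / (N - β₁ / (1 - β₁)) * Real.log (1 + R ^ 2 / ((1 - β₂) * ε))
              - N / (N - β₁ / (1 - β₁)) * Real.log β₂) := by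
  have hβ₂0 : 0 < β₂ := hβ₁.trans_lt hβ₁₂
  have hβ₁1 : β₁ < 1 := hβ₁₂.trans hβ₂
  have hc2 : 0 < 1 - β₂ := sub_pos.2 hβ₂
  have hR0 : 0 < R := (Real.sqrt_pos.2 hε).trans_le hR
  set s : ℕ → Ω → AdamState d := fun n ω => adamState α β₁ β₂ ε (fun n => f (ξ n ω)) x₀ n with hs
  set g : ℕ → Ω → EuclideanSpace ℝ (Fin d) := fun n ω => gradient (f (ξ n ω)) (s n ω).x with hg
  have hcoord : ∀ x : EuclideanSpace ℝ (Fin d), ∀ᵐ s ∂ν, ∀ i, |gradient (f s) x i| ≤ R - √ε :=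
    fun x => by
      filter_upwards [hf_bound x] with s h i
      exact (norm_le_pi_norm (WithLp.ofLp (gradient (f s) x)) i).trans h
  have hFB : ∀ x i, |gradient F x i| ≤ R - √ε := fun x i => by
    rw [← integral_gradient_apply hf_meas (hcoord x) (hf_mean x) i]
    have := norm_integral_le_of_norm_le_const (μ := ν) (f := fun s => gradient (f s) x i)
      (C := R - √ε) (by filter_upwards [hcoord x] with s h using h i)
    simpa using this
  have h𝓕 := pastSigma_le hξ_meas
  have hind := indep_pastSigma hξ_meas hξ_indep
  have hmeas := measurable_adamState (ξ := ξ) hf_meas α β₁ β₂ ε x₀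
  have hxm : ∀ n, Measurable[pastSigma ξ n] fun ω => (s n ω).x := fun n => (hmeas n).2.2
  have hgm : ∀ n, Measurable (g n) := fun n =>
    hf_meas.comp ((hξ_meas n).prodMk ((hxm n).mono (h𝓕 n) le_rfl))
  have hψ : ∀ i, Measurable fun p : EuclideanSpace ℝ (Fin d) × S => gradient (f p.2) p.1 i :=
    fun i => measurable_euclidean_apply (hf_meas.comp measurable_swap) i
  have hψB : ∀ n i (x : EuclideanSpace ℝ (Fin d)),
      ∀ᵐ s ∂P.map (ξ n), |gradient (f s) x i| ≤ R - √ε := fun n i x => by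
    rw [hξ_law]
    filter_upwards [hcoord x] with s h using h i
  have hgB : ∀ᵐ ω ∂P, ∀ n i, |g n ω i| ≤ R - √ε := by
    rw [ae_all_iff]
    intro n
    rw [ae_all_iff]
    intro i
    exact ae_prod_of_indep (h𝓕 n) (hξ_meas n) (hind n) (hxm n)
      (measurableSet_le (hψ i).abs measurable_const) (hψB n i)
  have hgF : ∀ n i, P[fun ω => g n ω i|pastSigma ξ n] =ᵐ[P] fun ω => gradient F (s n ω).x i := by
    intro n i
    have h := condExp_of_indep (h𝓕 n) (hξ_meas n) (hind n) (hxm n) (hψ i) (hψB n i)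
    simp only [hξ_law, integral_gradient_apply hf_meas (hcoord _) (hf_mean _)] at h
    exact h
  have hmain := sum_weighted_integral_norm_sq_gradient_le (P := P) (x := fun n ω => (s n ω).x)
    (m := fun n ω => (s n ω).m) (v := fun n ω => (s n ω).v) (g := g) (𝓕 := pastSigma ξ)
    hF hL0 hF_smooth hF_below hFB hε hR hα hβ₁ hβ₁₂ hβ₂ h𝓕 hxm (fun n => (hmeas n).2.1) hgm hgB
    hgF (x₀ := x₀) (fun _ => rfl) (fun _ => rfl) (fun _ => rfl) (fun _ _ _ => rfl)
    (fun _ _ _ => rfl) (fun _ _ _ => rfl) N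
  have hFcont : Continuous (gradient F) := continuous_gradient_of_lipschitz hL0 hF_smooth
  obtain ⟨hint, heq⟩ := integral_comp_of_indep (P := P) hτ_meas
    (m := MeasurableSpace.comap (fun ω n => ξ n ω) MeasurableSpace.pi)
    (measurable_pi_iff.2 hξ_meas).comap_le ((IndepFun_iff_Indep _ _ _).1 hτ_indep)
    (D := fun j ω => ‖gradient F (s j ω).x‖ ^ 2)
    (fun j => (measurable_norm.comp
      (hFcont.measurable.comp ((hxm j).mono (pastSigma_le_comap j) le_rfl))).pow_const 2)
    (C := d * (R - √ε) ^ 2) (fun j ω => by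
      rw [abs_of_nonneg (sq_nonneg _), EuclideanSpace.real_norm_sq_eq]
      calc _ ≤ ∑ _i : Fin d, (R - √ε) ^ 2 := Finset.sum_le_sum fun i _ =>
            sq_le_sq' (abs_le.1 (hFB _ i)).1 (abs_le.1 (hFB _ i)).2
        _ = _ := by simp)
  refine ⟨hint, heq.le.trans ?_⟩
  obtain ⟨c, hc⟩ := hτ_law
  set Nt : ℝ := N - β₁ / (1 - β₁) with hNt
  have hNt0 : 0 < Nt := sub_pos.2 hN
  have hZ := sub_div_le_sum_one_sub_pow hβ₁ hβ₁1 N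
  rw [← hNt] at hZ
  set Z := ∑ j ∈ Finset.range N, (1 - β₁ ^ (N - j)) with hZdef
  -- the normalizing constant of the law of `τ`
  have hcZ : c * Z = 1 := by
    rw [hZdef, Finset.mul_sum, Finset.sum_range fun j => c * (1 - β₁ ^ (N - j))]
    simp only [← hc]
    have h := sum_measureReal_preimage_singleton (μ := P) (f := τ) Finset.univ
      (fun j _ => hτ_meas (measurableSet_singleton j))
    rw [h]
    simp
  have hZ0 : 0 < Z := hNt0.trans_le hZ
  have hcval : c = 1 / Z := by field_simp; linarith
  have hc_le : c ≤ 1 / Nt := by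
    rw [hcval]
    exact one_div_le_one_div_of_le hNt0 hZ
  have hc0 : 0 ≤ c := by rw [hcval]; positivity
  have hsumτ : ∑ j : Fin N, P.real (τ ⁻¹' {j}) * ∫ ω, ‖gradient F (s j ω).x‖ ^ 2 ∂P
      = c * ∑ j ∈ Finset.range N, (1 - β₁ ^ (N - j)) * ∫ ω, ‖gradient F (s j ω).x‖ ^ 2 ∂P := by
    rw [Finset.mul_sum, Finset.sum_range fun j =>
      c * ((1 - β₁ ^ (N - j)) * ∫ ω, ‖gradient F (s j ω).x‖ ^ 2 ∂P)]
    simp only [hc, mul_assoc]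
  rw [hsumτ]
  set Q := Real.log (1 + R ^ 2 / ((1 - β₂) * ε)) - N * Real.log β₂ with hQ
  have hQ0 : 0 ≤ Q := log_factor_nonneg hε.le hβ₂0.le hβ₂ N
  have hC0 : 0 ≤ adamConst d α β₁ β₂ R L := adamConst_nonneg hL0 hR0.le hα.le hβ₁ hβ₁₂ hβ₂
  have hD0 : 0 ≤ F x₀ - Fstar := sub_nonneg.2 (hF_below x₀)
  have hbound : ∑ j ∈ Finset.range N, (1 - β₁ ^ (N - j)) * ∫ ω, ‖gradient F (s j ω).x‖ ^ 2 ∂P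
      ≤ 2 * R / α * (F x₀ - Fstar) + adamConst d α β₁ β₂ R L * Q := by
    have h := mul_le_mul_of_nonneg_left hmain (show 0 ≤ 2 * R / α by positivity)
    rw [mul_add, ← mul_assoc, ← mul_assoc, show 2 * R / α * (α / (2 * R)) = 1 by field_simp,
      one_mul, one_mul] at h
    exact h
  calc c * ∑ j ∈ Finset.range N, (1 - β₁ ^ (N - j)) * ∫ ω, ‖gradient F (s j ω).x‖ ^ 2 ∂P
      ≤ c * (2 * R / α * (F x₀ - Fstar) + adamConst d α β₁ β₂ R L * Q) := by gcongr
    _ ≤ 1 / Nt * (2 * R / α * (F x₀ - Fstar) + adamConst d α β₁ β₂ R L * Q) := by gcongr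
    _ = _ := by
        rw [hQ]
        field_simp

theorem theorem4
    -- dimension and objective function
    (d : ℕ) (F : EuclideanSpace ℝ (Fin d) → ℝ) (hF : Differentiable ℝ F)
    -- the random function `f s`, where the random parameter `s` has law `ν`
    {S : Type*} [MeasurableSpace S] (ν : Measure S) [IsProbabilityMeasure ν]
    (f : S → EuclideanSpace ℝ (Fin d) → ℝ)
    (hf_diff : ∀ x, ∀ᵐ s ∂ν, DifferentiableAt ℝ (f s) x)
    (hf_meas : Measurable fun p : S × EuclideanSpace ℝ (Fin d) => gradient (f p.1) p.2)
    (hf_mean : ∀ x, ∫ s, gradient (f s) x ∂ν = gradient F x)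
    -- i.i.d. samples of it: the `n`-th sample (counted from `0`) is `f (ξ n ω)`
    {Ω : Type*} [MeasurableSpace Ω] (P : Measure Ω) [IsProbabilityMeasure P]
    (ξ : ℕ → Ω → S) (hξ_meas : ∀ n, Measurable (ξ n))
    (hξ_indep : iIndepFun ξ P) (hξ_law : ∀ n, P.map (ξ n) = ν)
    -- `F` is bounded below, the stochastic gradients are bounded in sup norm, `F` is smooth
    (Fstar : ℝ) (hF_below : ∀ x, Fstar ≤ F x)
    (ε : ℝ) (hε : 0 < ε) (R : ℝ) (hR : Real.sqrt ε ≤ R)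
    (hf_bound : ∀ x : EuclideanSpace ℝ (Fin d), ∀ᵐ s ∂ν, ‖WithLp.ofLp (gradient (f s) x)‖ ≤ R - Real.sqrt ε)
    (L : ℝ) (hF_smooth : ∀ x y, ‖gradient F x - gradient F y‖ ≤ L * ‖x - y‖)
    -- hyper-parameters and starting point
    (α β₁ β₂ : ℝ) (hα : 0 < α) (hβ₁ : 0 ≤ β₁) (hβ₁₂ : β₁ < β₂) (hβ₂ : β₂ < 1)
    (x₀ : EuclideanSpace ℝ (Fin d))
    -- number of iterations and random index, drawn independently of the samples
    (N : ℕ) (hN : β₁ / (1 - β₁) < N)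
    (τ : Ω → Fin N) (hτ_meas : Measurable τ) (hτ_indep : IndepFun τ (fun ω n => ξ n ω) P)
    (hτ_law : ∃ c : ℝ, ∀ j : Fin N, P.real (τ ⁻¹' {j}) = c * (1 - β₁ ^ (N - (j : ℕ)))) :
    (Integrable (fun ω =>
        ‖gradient F (adamState α β₁ β₂ ε (fun n => f (ξ n ω)) x₀ (τ ω)).x‖ ^ 2) P ∧
      ∫ ω, ‖gradient F (adamState α β₁ β₂ ε (fun n => f (ξ n ω)) x₀ (τ ω)).x‖ ^ 2 ∂P
        ≤ 2 * R * ((F x₀ - Fstar) / (α * (N - β₁ / (1 - β₁))))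
          + adamConst d α β₁ β₂ R L
            * (1 / (N - β₁ / (1 - β₁)) * Real.log (1 + R ^ 2 / ((1 - β₂) * ε))
              - N / (N - β₁ / (1 - β₁)) * Real.log β₂)) ∧
    -- the order of the constant in `1 - β₁`
    adamConst d α β₁ β₂ R L
      ≤ ((1 - β₁) / (1 - β₁ / β₂)) ^ (3 / 2 : ℝ)
        * (α * d * R * L / (1 - β₂) + 12 * d * R ^ 2 / Real.sqrt (1 - β₂)
            + 2 * α ^ 2 * d * L ^ 2 / (1 - β₂) ^ (3 / 2 : ℝ))
        / (1 - β₁) := by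

  rcases Nat.eq_zero_or_pos d with rfl | hd
  · -- in dimension `0` the constant `L` is arbitrary and may be replaced by `0`
    have hC : ∀ L', adamConst 0 α β₁ β₂ R L' = 0 := fun L' => by simp [adamConst]
    have h := adam_bound_of_nonneg 0 F hF ν f hf_meas hf_mean P ξ hξ_meas hξ_indep hξ_law Fstar
      hF_below ε hε R hR hf_bound 0 le_rfl
      (fun x y => by simp [Subsingleton.elim (gradient F x) (gradient F y)]) α β₁ β₂ hα hβ₁ hβ₁₂
      hβ₂ x₀ N hN τ hτ_meas hτ_indep hτ_law
    rw [hC] at h ⊢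
    exact ⟨h, by simp⟩
  · have hL0 : 0 ≤ L := by
      have h := (norm_nonneg _).trans (hF_smooth (EuclideanSpace.single ⟨0, hd⟩ 1) 0)
      simpa using h
    exact ⟨adam_bound_of_nonneg d F hF ν f hf_meas hf_mean P ξ hξ_meas hξ_indep hξ_law Fstar
      hF_below ε hε R hR hf_bound L hL0 hF_smooth α β₁ β₂ hα hβ₁ hβ₁₂ hβ₂ x₀ N hN τ hτ_meas
      hτ_indep hτ_law, adamConst_le_order hL0 ((Real.sqrt_nonneg ε).trans hR) hα.le hβ₁ hβ₁₂ hβ₂⟩
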